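/- **Setting.** Let $\mathcal X$ be the set of symmetric probability measures on $\overline{\mathbb R}=[-\infty,\infty]$, i.e. Borel probability measures $x$ with $x(-E)=\int_E e^{-\alpha}\,x(d\alpha)$ for all Borel $E\subseteq(-\infty,\infty]$. For $x_1,x_2\in\mathcal X$ let $x_1\circledast x_2$ be the law of $\alpha_1+\alpha_2$ and $x_1\boxtimes x_2$ the law of $\tau^{-1}(\tau(\alpha_1)\tau(\alpha_2))$, where $\alpha_1\sim x_1$, $\alpha_2\sim x_2$ are independent and $\tau(\alpha)=\tanh(\alpha/2)$. For a polynomial $p(t)=\sum_n p_nt^n$ with nonnegative coefficients put $p^{\circledast}(x)=\sum_n p_n x^{\circledast n}$ and $p^{\boxtimes}(x)=\sum_n p_n x^{\boxtimes n}$, where $x^{\circledast 0}=\Delta_0$, $x^{\boxtimes 0}=\Delta_\infty$ and $\Delta_a$ is the point mass at $a$. Let $\mathrm H(x)=\int\log_2(1+e^{-\alpha})\,x(d\alpha)$ and, for $x_1,x_2\in\mathcal X$, $$d_{\mathrm H}(x_1,x_2)=\sum_{k\ge1}\tfrac{1}{(\log 2)\,2k(2k-1)}\Big|\int\tanh^{2k}(\tfrac\alpha2)\,dx_1-\int\tanh^{2k}(\tfrac\alpha2)\,dx_2\Big|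 .$$ Write $x_1\succeq x_2$ ($x_1$ is degraded with respect to $x_2$) if $\int f(|\tanh\frac\alpha2|)\,dx_1\ge\int f(|\tanh\frac\alpha2|)\,dx_2$ for every concave non-increasing $f:[0,1]\to\mathbb R$. A *family of BMS channels* is a map $c:[0,1]\to\mathcal X$ with $c(h_1)\succeq c(h_2)$ whenever $h_1\ge h_2$, and $\mathrm H(c(h))=h$ for all $h$. An LDPC$(\lambda,\rho)$ ensemble is given by polynomials $\lambda,\rho$ with nonnegative coefficients, $\lambda(1)=\rho(1)=1$ and $\lambda(0)=0$ (no degree-one variable nodes); $L(t)=\int_0^t\lambda/\int_0^1\lambda$ and $R(t)=\int_0^t\rho/\int_0^1\rho$ are the node-perspective degree distributions, so $\lambda=L'/L'(1)$ and $\rho=R'/R'(1)$. For $a,x,c\in\mathcal X$ let $T_{\mathrm s}(a;c)=c\circledast\lambda^{\circledast}(\rho^{\boxtimes}(a))$ and $$U_{\mathrm s}(x;c)=\tfrac{L'(1)}{R'(1)}\mathrm H(R^{\boxtimes}(x))+L'(1)\mathrm H(\rho^{\boxtimes}(x))-L'(1)\mathrm H(x\boxtimes\rho^{\boxtimes}(x))-\mathrm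 H\big(c\circledast L^{\circledast}(\rho^{\boxtimes}(x))\big).$$ Let $\mathcal V(c)$ be the set of $a\in\mathcal X$ for which the iterates $T_{\mathrm s}^{(\ell)}(a;c)$ converge to $\Delta_\infty$ in $d_{\mathrm H}$, let $\Delta E(c)=\inf_{x\in\mathcal X\setminus\mathcal V(c)}U_{\mathrm s}(x;c)\in[-\infty,\infty]$ (with $\inf\emptyset=\infty$), let $h^*=\sup\{h\in[0,1]:\Delta E(c(h))>0\}$, and let $$K_{\lambda,\rho}=L'(1)\big(2\rho''(1)+\rho'(1)+2\lambda'(1)\rho'(1)^2\big).$$ For integers $N\ge 0$, $w\ge1$ put $N_w=2N+w-1$. The density evolution of the spatially-coupled $(\lambda,\rho,N,w)$ ensemble with channel $c$ is the map $T_{\mathrm c}(\,\cdot\,;c)$ on $\mathcal X^{N_w}$ given, for $1\le i\le N_w$, by $$T_{\mathrm c}(\underline x;c)_i=\frac1w\sum_{k=0}^{w-1}c_{i-k}\circledast\lambda^{\circledast}\Big(\frac1w\sum_{j=0}^{w-1}\rho^{\boxtimes}(x_{i-k+j})\Big),$$ where $x_m=\Delta_\infty$ for $m\notin\{1,\dots,N_w\}$,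 $c_m=c$ for $1\le m\le 2N$ and $c_m=\Delta_\infty$ otherwise. **Theorem.** Fix a family of BMS channels $c(\cdot)$ and an LDPC$(\lambda,\rho)$ ensemble. For every $h\in[0,1]$ with $h<h^*$, every $N$, and every $w>K_{\lambda,\rho}/(2\Delta E(c(h)))$ (the right-hand side being $0$ if $\Delta E(c(h))=\infty$), the only fixed point $\underline x\in\mathcal X^{N_w}$ of $T_{\mathrm c}(\,\cdot\,;c(h))$ is $\underline{\Delta_\infty}=(\Delta_\infty,\dots,\Delta_\infty)$. -/

import Mathlib

open MeasureTheory Filter Topology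
open scoped NNReal ENNReal Polynomial

namespace SCLDPC

noncomputable section

/-! ### Symmetric probability measures on the extended reals -/

/-- A measure on the extended reals is symmetric if `x(-E) = ∫_E e^{-α} x(dα)` for every Borel set
`E ⊆ (-∞, ∞]`. (At `α = -∞` the density `e^{-α}` is infinite; such points are reached through `-E`:
the choice `E = {∞}` gives `x({-∞}) = 0`.) -/
def IsSymmetric (x : Measure EReal) : Prop :=
  ∀ E : Set EReal, MeasurableSet E → ⊥ ∉ E →
    x (Neg.neg ⁻¹' E) = ∫⁻ a in E, EReal.exp (-a) ∂x

/-- The set `𝒳` of symmetric probability measures on the extended reals. -/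
def symProb : Set (Measure EReal) :=
  {x | IsProbabilityMeasure x ∧ IsSymmetric x}

/-- `Δ_0`, the point mass at `0`. -/
def deltaZero : Measure EReal := Measure.dirac 0

/-- `Δ_∞`, the point mass at `+∞`. -/
def deltaInf : Measure EReal := Measure.dirac ⊤

/-- `τ(α) = tanh(α/2)`, from the extended reals onto `[-1, 1]`. -/
def tau (α : EReal) : ℝ :=
  EReal.rec (-1) (fun a : ℝ => Real.tanh (a / 2)) 1 α

@[simp] theorem tau_bot : tau ⊥ = -1 := rfl

@[simp] theorem tau_top : tau ⊤ = 1 := rfl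

@[simp] theorem tau_coe (a : ℝ) : tau (a : EReal) = Real.tanh (a / 2) := rfl

/-- `τ⁻¹(t) = 2 artanh t`, from `[-1, 1]` to the extended reals. -/
def tauInv (t : ℝ) : EReal :=
  if t ≤ -1 then ⊥ else if 1 ≤ t then ⊤ else ((2 * Real.artanh t : ℝ) : EReal)

/-- The variable-node operation: the law of `α₁ + α₂`, that is, additive convolution. -/
def varOp (x y : Measure EReal) : Measure EReal :=
  Measure.conv x y

/-- The check-node operation: the law of `τ⁻¹(τ(α₁) τ(α₂))`. -/
def chkOp (x y : Measure EReal) : Measure EReal :=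
  (x.prod y).map fun p => tauInv (tau p.1 * tau p.2)

/-- The `n`-fold power of `x` under the operation `op` with identity `e`. -/
def opPow (op : Measure EReal → Measure EReal → Measure EReal) (e x : Measure EReal) :
    ℕ → Measure EReal
  | 0 => e
  | n + 1 => op (opPow op e x n) x

/-- `p^⊛(x) = ∑ₙ pₙ x^{⊛ n}`, where `x^{⊛ 0} = Δ_0`. -/
def varPoly (p : ℝ≥0[X]) (x : Measure EReal) : Measure EReal :=
  ∑ n ∈ p.support, p.coeff n • opPow varOp deltaZero x n

/-- `p^⊠(x) = ∑ₙ pₙ x^{⊠ n}`, where `x^{⊠ 0} = Δ_∞`. -/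
def chkPoly (p : ℝ≥0[X]) (x : Measure EReal) : Measure EReal :=
  ∑ n ∈ p.support, p.coeff n • opPow chkOp deltaInf x n

/-- The uniform average `(1/w) ∑_{k=0}^{w-1} f k` of `w` measures. -/
def average (w : ℕ) (f : ℕ → Measure EReal) : Measure EReal :=
  (w : ℝ≥0)⁻¹ • ∑ k ∈ Finset.range w, f k

/-! ### Degradation, entropy and the entropy distance -/

/-- `x₁` is degraded with respect to `x₂`: `∫ f(|tanh(α/2)|) dx₁ ≥ ∫ f(|tanh(α/2)|) dx₂` for all
concave non-increasing `f : [0, 1] → ℝ`. -/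
def Degraded (x₁ x₂ : Measure EReal) : Prop :=
  ∀ f : ℝ → ℝ, ConcaveOn ℝ (Set.Icc 0 1) f → AntitoneOn f (Set.Icc 0 1) →
    ∫ a, f |tau a| ∂x₂ ≤ ∫ a, f |tau a| ∂x₁

/-- The entropy functional `H(x) = ∫ log₂(1 + e^{-α}) x(dα)`. (Symmetric measures do not charge
`-∞`, the only point where the integrand is not finite.) -/
def entropy (x : Measure EReal) : ℝ :=
  ∫ a, Real.logb 2 (1 + (EReal.exp (-a)).toReal) ∂x

/-- `M_k(x) = ∫ tanh(α/2)^{2k} x(dα)`. -/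
def tanhMoment (k : ℕ) (x : Measure EReal) : ℝ :=
  ∫ a, tau a ^ (2 * k) ∂x

/-- `γ_k = 1 / (log 2 · 2k(2k-1))`. -/
def gammaCoeff (k : ℕ) : ℝ :=
  (Real.log 2)⁻¹ / (2 * (k : ℝ) * (2 * (k : ℝ) - 1))

/-- The entropy distance `d_H(x₁, x₂) = ∑_{k ≥ 1} γ_k |M_k(x₁) - M_k(x₂)|`. -/
def entropyDist (x₁ x₂ : Measure EReal) : ℝ :=
  ∑' k : ℕ, gammaCoeff (k + 1) * |tanhMoment (k + 1) x₁ - tanhMoment (k + 1) x₂|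

/-- A family of BMS channels, indexed by `h ∈ [0, 1]`: ordered by degradation and parameterized
by entropy. -/
structure IsBMSFamily (c : ℝ → Measure EReal) : Prop where
  mem : ∀ h ∈ Set.Icc (0 : ℝ) 1, c h ∈ symProb
  degraded : ∀ h₁ ∈ Set.Icc (0 : ℝ) 1, ∀ h₂ ∈ Set.Icc (0 : ℝ) 1, h₂ ≤ h₁ → Degraded (c h₁) (c h₂)
  entropy_eq : ∀ h ∈ Set.Icc (0 : ℝ) 1, entropy (c h) = h

/-! ### The LDPC ensemble -/

/-- The polynomial `t ↦ ∫₀ᵗ p`. -/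
def antideriv (p : ℝ≥0[X]) : ℝ≥0[X] :=
  ∑ n ∈ p.support, Polynomial.monomial (n + 1) (p.coeff n / ((n : ℝ≥0) + 1))

/-- The node-perspective degree distribution `t ↦ ∫₀ᵗ p / ∫₀¹ p` of the edge-perspective degree
distribution `p`. -/
def nodePersp (p : ℝ≥0[X]) : ℝ≥0[X] :=
  Polynomial.C ((antideriv p).eval 1)⁻¹ * antideriv p

/-- An irregular ensemble LDPC(λ, ρ), given by its edge-perspective degree distributions: `λ` and
`ρ` are polynomials with nonnegative coefficients summing to one, and there are no degree-one
variable nodes, i.e. `λ(0) = 0`. -/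
structure Ensemble where
  lam : ℝ≥0[X]
  rho : ℝ≥0[X]
  lam_one : lam.eval 1 = 1
  rho_one : rho.eval 1 = 1
  lam_zero : lam.eval 0 = 0

namespace Ensemble

variable (E : Ensemble)

/-- The node-perspective variable degree distribution. -/
def L : ℝ≥0[X] := nodePersp E.lam

/-- The node-perspective check degree distribution. -/
def R : ℝ≥0[X] := nodePersp E.rho

/-- `L'(1)`, the average variable-node degree. -/
def dL : ℝ≥0 := E.L.derivative.eval 1

/-- `R'(1)`, the average check-node degree. -/
def dR : ℝ≥0 := E.R.derivative.eval 1

/-- One iteration of density evolution: `T_s(a; c) = c ⊛ λ^⊛(ρ^⊠(a))`. -/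
def deStep (c a : Measure EReal) : Measure EReal :=
  varOp c (varPoly E.lam (chkPoly E.rho a))

/-- The potential functional `U_s(x; c)`. -/
def potential (x c : Measure EReal) : ℝ :=
  (E.dL : ℝ) / E.dR * entropy (chkPoly E.R x) + E.dL * entropy (chkPoly E.rho x)
    - E.dL * entropy (chkOp x (chkPoly E.rho x))
    - entropy (varOp c (varPoly E.L (chkPoly E.rho x)))

/-- The basin of attraction to `Δ_∞`: the `a ∈ 𝒳` from which density evolution converges to `Δ_∞`
in the entropy distance. -/
def basin (c : Measure EReal) : Set (Measure EReal) :=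
  {a | a ∈ symProb ∧
    Tendsto (fun l : ℕ => entropyDist ((E.deStep c)^[l] a) deltaInf) atTop (𝓝 0)}

/-- The energy gap `ΔE(c)`, the infimum of `U_s(·; c)` over `𝒳 ∖ 𝒱(c)`; it is `∞` if this set
is empty. -/
def energyGap (c : Measure EReal) : EReal :=
  ⨅ x ∈ symProb \ E.basin c, (E.potential x c : EReal)

/-- The potential threshold `h* = sup {h ∈ [0, 1] | ΔE(c(h)) > 0}`. -/
def potentialThreshold (c : ℝ → Measure EReal) : ℝ :=
  sSup {h | h ∈ Set.Icc (0 : ℝ) 1 ∧ 0 < E.energyGap (c h)}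

/-- `K_{λ,ρ} = L'(1) (2 ρ''(1) + ρ'(1) + 2 λ'(1) ρ'(1)²)`. -/
def K : ℝ≥0 :=
  E.dL * (2 * E.rho.derivative.derivative.eval 1 + E.rho.derivative.eval 1
    + 2 * E.lam.derivative.eval 1 * E.rho.derivative.eval 1 ^ 2)

end Ensemble

/-! ### The spatially-coupled system -/

/-- The check-node positions `{1, …, 2N + w - 1}` (as integers). -/
abbrev CheckPos (N w : ℕ) : Type := Set.Icc (1 : ℤ) (2 * (N : ℤ) + (w : ℤ) - 1)

open Classical in
/-- Extension of a vector of check-node inputs by the boundary value `Δ_∞`. -/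
def extend {N w : ℕ} (x : CheckPos N w → Measure EReal) (i : ℤ) : Measure EReal :=
  if h : i ∈ Set.Icc (1 : ℤ) (2 * (N : ℤ) + (w : ℤ) - 1) then x ⟨i, h⟩ else deltaInf

/-- The channel `c_i` at position `i`: it is `c` at the variable-node positions `1, …, 2N` and
`Δ_∞` elsewhere. -/
def channelAt (N : ℕ) (c : Measure EReal) (i : ℤ) : Measure EReal :=
  if 1 ≤ i ∧ i ≤ 2 * (N : ℤ) then c else deltaInf

/-- One iteration of the density evolution of the spatially-coupled `(λ, ρ, N, w)` system:
`T_c(x; c)_i = (1/w) ∑_{k<w} c_{i-k} ⊛ λ^⊛((1/w) ∑_{j<w} ρ^⊠(x_{i-k+j}))`. -/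
def Ensemble.coupledStep (E : Ensemble) {N w : ℕ} (c : Measure EReal)
    (x : CheckPos N w → Measure EReal) : CheckPos N w → Measure EReal := fun i =>
  average w fun k => varOp (channelAt N c (i - k))
    (varPoly E.lam (average w fun j => chkPoly E.rho (extend x (i - k + j))))

/-- The fixed points, among vectors of symmetric probability measures, of the density evolution of
the spatially-coupled `(λ, ρ, N, w)` system with channel `c`. -/
def Ensemble.coupledFixedPoints (E : Ensemble) (N w : ℕ) (c : Measure EReal) :
    Set (CheckPos N w → Measure EReal) :=
  {x | (∀ i, x i ∈ symProb) ∧ E.coupledStep c x = x}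

/-! ### The two perspectives on the degree distributions agree -/

theorem derivative_antideriv (p : ℝ≥0[X]) : (antideriv p).derivative = p := by
  conv_rhs => rw [p.as_sum_support]
  rw [antideriv, Polynomial.derivative_sum]
  refine Finset.sum_congr rfl fun n _ => ?_
  have hn : ((n : ℝ≥0) + 1) ≠ 0 := by positivity
  rw [Polynomial.derivative_monomial]
  push_cast
  rw [div_mul_cancel₀ _ hn]

theorem antideriv_eval_one_ne_zero {p : ℝ≥0[X]} (hp : p.eval 1 = 1) :
    (antideriv p).eval 1 ≠ 0 := by
  intro h
  rw [antideriv, Polynomial.eval_finsetSum, Finset.sum_eq_zero_iff] at h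
  have h0 : p = 0 := by
    ext n
    by_contra hn
    have hmem : n ∈ p.support := by
      rw [Polynomial.mem_support_iff]
      intro h'
      exact hn (by rw [h']; simp)
    have := h n hmem
    simp only [Polynomial.eval_monomial, one_pow, mul_one] at this
    rcases div_eq_zero_iff.mp this with h1 | h1
    · exact Polynomial.mem_support_iff.mp hmem h1
    · have : ((n : ℝ≥0) + 1) ≠ 0 := by positivity
      exact this h1
  rw [h0] at hp
  simp at hp

/-- The node-perspective distribution `P` of `p` satisfies `P(0) = 0`, `P(1) = 1` and
`P' = P'(1) p` with `P'(1) ≠ 0`. -/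
theorem nodePersp_spec {p : ℝ≥0[X]} (hp : p.eval 1 = 1) :
    (nodePersp p).eval 0 = 0 ∧ (nodePersp p).eval 1 = 1 ∧
      (nodePersp p).derivative.eval 1 ≠ 0 ∧
      (nodePersp p).derivative = Polynomial.C ((nodePersp p).derivative.eval 1) * p := by
  have hne := antideriv_eval_one_ne_zero hp
  have hd : (nodePersp p).derivative = Polynomial.C ((antideriv p).eval 1)⁻¹ * p := by
    rw [nodePersp, Polynomial.derivative_C_mul, derivative_antideriv]
  have he : (nodePersp p).derivative.eval 1 = ((antideriv p).eval 1)⁻¹ := by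
    rw [hd]; simp [hp]
  refine ⟨?_, ?_, ?_, ?_⟩
  · simp [nodePersp, antideriv, Polynomial.eval_finsetSum]
  · simp [nodePersp, hne]
  · rw [he]; exact inv_ne_zero hne
  · rw [he, hd]

end

end SCLDPC

namespace SCLDPC

noncomputable section

/-! ### The map `τ` and its inverse -/

/-! Everything is read off from the moments M_k(x) = ∫ τ^{2k} dx. For symmetric laws H(x) = ∫ (1 -
M_k(x)) dγ(k) with γ a probability measure on the indices (`entropy_eq_integral`). The moments are
multiplicative under ⊠, and the duality rule H(x ⊛ y) + H(x ⊠ y) = H(x) + H(y) turns this into H(x ⊛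
y) = ∫ (1 - M_k(x))(1 - M_k(y)) dγ(k) (`entropy_varOp`). Both node operations also preserve
degradation (`Degraded.varOp`, `Degraded.chkOp`).

Suppose the coupled system has a nontrivial fixed point. It is compared with a one-sided chain that
starts from Δ_0 and whose right end is replaced by constant repetition of position n = 2N + w - 1.
The iterates X_l of this chain improve with l, worsen with the position, and are all degraded with
respect to the fixed point (`chainIter_degraded_extend`). Uncoupled density evolution started from
X_l(n) is worse still (`deStep_iterate_degraded_chainIter`), so it cannot reach Δ_∞. Hence X_l(n)
lies outside the basin and ΔE ≤ U_s(X_l(n)).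

The energy estimate `potential_le_of_chain` bounds this potential from above. Both its check part
and its variable part are telescoped along the chain. The increments of the check part are
controlled by convexity of R alone (`checkPotential_sub_le`), those of the variable part by a
second-order expansion (`entropy_var_taylor`). Summation by parts moves the window average from the
check outputs to the variable outputs, which produces exactly one step of the chain; the first-order
terms then amount to at most L'(1) times the total entropy lost in that step. In the second-order
terms one factor is at most ρ'(1)/w, since neighbouring windows differ in one entry, and the other
factor telescopes. So U_s(X_l(n)) ≤ L'(1) λ'(1) ρ'(1)²/(2w) + L'(1) · (entropy loss at step l).

The entropies decrease in l and are nonnegative, so the loss tends to 0 and ΔE ≤ L'(1) λ'(1)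
ρ'(1)²/(2w) ≤ K/(4w), contradicting w > K/(2ΔE). Only limits of real numbers occur: no limiting
measure and no compactness of 𝒳 is needed. -/

@[fun_prop] theorem measurable_tau : Measurable tau :=
  EReal.measurable_of_measurable_real (by
    simp only [tau_coe, Real.tanh_eq_sinh_div_cosh]; fun_prop)

theorem measurable_tauInv : Measurable tauInv := by
  unfold tauInv Real.artanh
  refine Measurable.ite measurableSet_Iic measurable_const
    (Measurable.ite measurableSet_Ici measurable_const ?_)
  exact measurable_coe_real_ereal.comp (by fun_prop)

theorem tau_mem (a : EReal) : tau a ∈ Set.Icc (-1 : ℝ) 1 := by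
  induction a with
  | bot => simp
  | coe a => exact ⟨(Real.neg_one_lt_tanh _).le, (Real.tanh_lt_one _).le⟩
  | top => simp

theorem neg_one_le_tau (a : EReal) : -1 ≤ tau a := (tau_mem a).1

theorem tau_le_one (a : EReal) : tau a ≤ 1 := (tau_mem a).2

theorem abs_tau_le_one (a : EReal) : |tau a| ≤ 1 := abs_le.mpr (tau_mem a)

@[simp] theorem tau_neg (a : EReal) : tau (-a) = -tau a := by
  induction a with
  | bot => simp
  | coe a => rw [← EReal.coe_neg, tau_coe, tau_coe, neg_div, Real.tanh_neg]
  | top => simp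

@[simp] theorem tau_zero : tau 0 = 0 := by
  rw [← EReal.coe_zero, tau_coe]; simp

theorem tau_eq_one_iff {a : EReal} : tau a = 1 ↔ a = ⊤ := by
  induction a with
  | bot => norm_num
  | coe a => simpa using (Real.tanh_lt_one _).ne
  | top => simp

theorem tau_eq_neg_one_iff {a : EReal} : tau a = -1 ↔ a = ⊥ := by
  rw [← neg_eq_iff_eq_neg, ← tau_neg, tau_eq_one_iff, EReal.neg_eq_top_iff]

theorem tau_tauInv {t : ℝ} (ht : |t| ≤ 1) : tau (tauInv t) = t := by
  obtain ⟨h1, h2⟩ := abs_le.mp ht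
  unfold tauInv
  split_ifs with h3 h4
  · rw [tau_bot]; linarith
  · rw [tau_top]; linarith
  · push Not at h3 h4
    rw [tau_coe, mul_div_cancel_left₀ _ two_ne_zero, Real.tanh_artanh ⟨h3, h4⟩]

theorem tau_injective : Function.Injective tau := by
  intro a b h
  induction a with
  | bot => exact (tau_eq_neg_one_iff.mp (by rw [← h, tau_bot])).symm
  | top => exact (tau_eq_one_iff.mp (by rw [← h, tau_top])).symm
  | coe a =>
    induction b with
    | bot => exact tau_eq_neg_one_iff.mp (by rw [h, tau_bot])
    | top => exact tau_eq_one_iff.mp (by rw [h, tau_top])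
    | coe b =>
      have := Real.tanh_injective h
      rw [EReal.coe_eq_coe_iff]; linarith

theorem tauInv_neg {t : ℝ} (ht : |t| ≤ 1) : tauInv (-t) = -tauInv t :=
  tau_injective (by rw [tau_neg, tau_tauInv ht, tau_tauInv (by rwa [abs_neg])])

theorem abs_tau_mul_tau_le_one (a b : EReal) : |tau a * tau b| ≤ 1 := by
  rw [abs_mul]
  exact mul_le_one₀ (abs_tau_le_one a) (abs_nonneg _) (abs_tau_le_one b)

theorem one_add_tau_mul_nonneg (a b : EReal) : 0 ≤ 1 + tau a * tau b := by
  linarith [(abs_le.mp (abs_tau_mul_tau_le_one a b)).1]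

/-- These are the points where the addition theorem below has a vanishing denominator and where `a +
b` is the conventional value ⊥ of ∞ - ∞. -/
theorem tau_mul_eq_neg_one {a b : EReal} (h : 1 + tau a * tau b = 0) :
    (a = ⊤ ∧ b = ⊥) ∨ (a = ⊥ ∧ b = ⊤) := by
  have ha := tau_mem a
  have hb := tau_mem b
  have hsq : tau a ^ 2 = 1 := by nlinarith [ha.1, ha.2, hb.1, hb.2, sq_nonneg (tau a + tau b)]
  rcases mul_self_eq_one_iff.mp ((sq _).symm.trans hsq) with h1 | h1
  · exact .inl ⟨tau_eq_one_iff.mp h1, tau_eq_neg_one_iff.mp (by rw [h1] at h; linarith)⟩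
  · exact .inr ⟨tau_eq_neg_one_iff.mp h1, tau_eq_one_iff.mp (by rw [h1] at h; linarith)⟩

/-- The addition theorem for `tanh`. -/
theorem one_add_mul_tau_add {a b : EReal} (h : 1 + tau a * tau b ≠ 0) :
    tau (a + b) = (tau a + tau b) / (1 + tau a * tau b) := by
  rw [eq_div_iff h]
  induction a with
  | bot =>
    induction b with
    | bot => norm_num
    | top => norm_num at h
    | coe b => simp; ring
  | top =>
    induction b with
    | bot => norm_num at h
    | top => norm_num
    | coe b => simp
  | coe a =>
    induction b with
    | bot => simp
    | top => simp; ring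
    | coe b =>
      rw [← EReal.coe_add, tau_coe, tau_coe, tau_coe, add_div]
      simp only [Real.tanh_eq_sinh_div_cosh, Real.sinh_add, Real.cosh_add]
      have h1 := (Real.cosh_pos (a / 2)).ne'
      have h2 := (Real.cosh_pos (b / 2)).ne'
      have h3 : Real.cosh (b / 2) * Real.cosh (a / 2) + Real.sinh (a / 2) * Real.sinh (b / 2) ≠ 0 := by
        rw [mul_comm (Real.cosh _), ← Real.cosh_add]; exact (Real.cosh_pos _).ne'
      field_simp

theorem abs_tau_neg_add_neg (a b : EReal) : |tau (-a + -b)| = |tau (a + b)| := by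
  by_cases h : 1 + tau a * tau b = 0
  -- Here both sums equal ⊥, so negation does not pass through the sum; only the absolute values
  -- agree.
  · rcases tau_mul_eq_neg_one h with ⟨rfl, rfl⟩ | ⟨rfl, rfl⟩ <;> simp
  · rw [one_add_mul_tau_add h, one_add_mul_tau_add (by simpa using h)]
    simp only [tau_neg, neg_mul_neg, ← neg_add, neg_div, abs_neg]

/-- The likelihood ratio is e^{-α} = (1 - τ)/(1 + τ). This is what trades the unbounded weight in
the symmetry condition for bounded ones. -/
theorem exp_neg_mul_one_add_tau {a : EReal} (ha : a ≠ ⊥) :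
    ENNReal.ofReal (1 + tau a) * EReal.exp (-a) = ENNReal.ofReal (1 - tau a) := by
  induction a with
  | bot => exact absurd rfl ha
  | top => simp
  | coe a =>
    rw [← EReal.coe_neg, EReal.exp_coe, tau_coe,
      ← ENNReal.ofReal_mul (by linarith [Real.neg_one_lt_tanh (a / 2)])]
    congr 1
    have h : Real.exp (-a) = Real.exp (-(a / 2)) * Real.exp (-(a / 2)) := by
      rw [← Real.exp_add]; congr 1; ring
    have h0 : Real.exp (a / 2) * Real.exp (-(a / 2)) = 1 := by rw [← Real.exp_add]; simp
    rw [Real.tanh_eq, h]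
    have h1 := Real.exp_pos (a / 2)
    have h2 := Real.exp_pos (-(a / 2))
    field_simp
    linear_combination (2 * Real.exp (-(a / 2))) * h0

/-! ### Symmetric measures -/

/-- The measure `(1 - τ) dx`, which is invariant under negation exactly if `x` is symmetric. -/
def tilt (x : Measure EReal) : Measure EReal :=
  x.withDensity fun a => ENNReal.ofReal (1 - tau a)

theorem lintegral_tilt (x : Measure EReal) {g : EReal → ℝ≥0∞} (hg : Measurable g) :
    ∫⁻ a, g a ∂tilt x = ∫⁻ a, ENNReal.ofReal (1 - tau a) * g a ∂x := by
  rw [tilt, lintegral_withDensity_eq_lintegral_mul _ (by fun_prop) hg]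
  rfl

theorem lintegral_tilt_comp_neg (x : Measure EReal) {g : EReal → ℝ≥0∞} (hg : Measurable g) :
    ∫⁻ a, g (-a) ∂tilt x = ∫⁻ a, ENNReal.ofReal (1 - tau a) * g (-a) ∂x :=
  lintegral_tilt x (hg.comp measurable_neg)

theorem IsSymmetric.bot_eq_zero {x : Measure EReal} (hx : IsSymmetric x) : x {⊥} = 0 := by
  have h := hx {⊤} (measurableSet_singleton _) (by simp)
  have h1 : Neg.neg ⁻¹' ({⊤} : Set EReal) = {⊥} := by
    ext a; simp
  rw [h1] at h
  rw [h, Measure.restrict_singleton]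
  simp

theorem IsSymmetric.ae_ne_bot {x : Measure EReal} (hx : IsSymmetric x) : ∀ᵐ a ∂x, a ≠ ⊥ := by
  rw [ae_iff]
  simpa using hx.bot_eq_zero

/-- Symmetry only speaks of sets avoiding ⊥, so it identifies the two measures off ⊥; `g` has to
vanish there. -/
theorem IsSymmetric.lintegral_neg {x : Measure EReal} (hx : IsSymmetric x) {g : EReal → ℝ≥0∞}
    (hg : Measurable g) (h0 : g ⊥ = 0) :
    ∫⁻ a, g (-a) ∂x = ∫⁻ a, EReal.exp (-a) * g a ∂x := by
  have hm : Measurable fun a : EReal => EReal.exp (-a) := by fun_prop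
  have key : (x.map Neg.neg).restrict {⊥}ᶜ =
      (x.withDensity fun a => EReal.exp (-a)).restrict {⊥}ᶜ := by
    ext E hE
    have hE' : MeasurableSet (E ∩ {⊥}ᶜ) := hE.inter (measurableSet_singleton _).compl
    rw [Measure.restrict_apply hE, Measure.restrict_apply hE, Measure.map_apply measurable_neg hE',
      withDensity_apply _ hE']
    exact hx _ hE' (by simp)
  have hs : Function.support g ⊆ {⊥}ᶜ := by
    intro a ha h
    rw [Set.mem_singleton_iff] at h
    exact ha (h ▸ h0)
  calc ∫⁻ a, g (-a) ∂x = ∫⁻ a, g a ∂(x.map Neg.neg) := (lintegral_map hg measurable_neg).symm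
    _ = ∫⁻ a in {⊥}ᶜ, g a ∂(x.map Neg.neg) := (setLIntegral_eq_of_support_subset hs).symm
    _ = ∫⁻ a in {⊥}ᶜ, g a ∂(x.withDensity fun a => EReal.exp (-a)) := by rw [key]
    _ = ∫⁻ a, g a ∂(x.withDensity fun a => EReal.exp (-a)) := setLIntegral_eq_of_support_subset hs
    _ = ∫⁻ a, EReal.exp (-a) * g a ∂x := by
      rw [lintegral_withDensity_eq_lintegral_mul _ hm hg]; rfl

/-- Test the symmetry condition against (1 + τ) g: since (1 + τ) e^{-α} = 1 - τ, it becomes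
invariance of the finite-density measure (1 - τ) dx. The closure proofs use this form. -/
theorem isSymmetric_iff_map_tilt (x : Measure EReal) :
    IsSymmetric x ↔ (tilt x).map Neg.neg = tilt x := by
  constructor
  · intro hx
    refine Measure.ext_of_lintegral _ fun g hg => ?_
    rw [lintegral_map hg measurable_neg, lintegral_tilt x hg,
      lintegral_tilt_comp_neg x hg]
    have h := hx.lintegral_neg (g := fun a => ENNReal.ofReal (1 + tau a) * g a) (by fun_prop)
      (by simp)
    simp only [tau_neg, ← sub_eq_add_neg] at h
    rw [h]
    refine lintegral_congr_ae (hx.ae_ne_bot.mono fun a ha => ?_)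
    simp only
    rw [← mul_assoc, mul_comm (EReal.exp _), exp_neg_mul_one_add_tau ha]
  · intro hx E hE hbot
    -- Dividing by 1 + τ undoes the tilt; it is legitimate on `E` because 1 + τ vanishes only at ⊥.
    have hg : Measurable (E.indicator fun a => (ENNReal.ofReal (1 + tau a))⁻¹) :=
      Measurable.indicator (by fun_prop) hE
    have h : ∫⁻ a, (E.indicator fun a => (ENNReal.ofReal (1 + tau a))⁻¹) a ∂(tilt x).map Neg.neg
      = ∫⁻ a, (E.indicator fun a => (ENNReal.ofReal (1 + tau a))⁻¹) a ∂tilt x := by rw [hx]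
    rw [lintegral_map hg measurable_neg, lintegral_tilt x hg,
      lintegral_tilt_comp_neg x hg] at h
    have hpos : ∀ {a : EReal}, a ≠ ⊥ → ENNReal.ofReal (1 + tau a) ≠ 0 := fun {a} ha => by
      have h1 : tau a ≠ -1 := fun h => ha (tau_eq_neg_one_iff.mp h)
      have h2 := lt_of_le_of_ne (neg_one_le_tau a) h1.symm
      exact (ENNReal.ofReal_pos.mpr (by linarith)).ne'
    rw [← lintegral_indicator_one (measurable_neg hE), ← lintegral_indicator hE]
    convert h using 2 with a a
    · ext a
      by_cases ha : -a ∈ E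
      · have hne : -a ≠ ⊥ := fun h => hbot (h ▸ ha)
        simp only [Set.indicator, Set.mem_preimage, ha, if_true, Pi.one_apply, tau_neg,
          ← sub_eq_add_neg]
        have := hpos hne
        rw [tau_neg, ← sub_eq_add_neg] at this
        exact (ENNReal.mul_inv_cancel this ENNReal.ofReal_ne_top).symm
      · simp [Set.indicator, ha]
    · ext a
      by_cases ha : a ∈ E
      · have hne : a ≠ ⊥ := fun h => hbot (h ▸ ha)
        simp only [Set.indicator, ha, if_true]
        rw [← exp_neg_mul_one_add_tau hne, mul_comm, ← mul_assoc,
          ENNReal.inv_mul_cancel (hpos hne) ENNReal.ofReal_ne_top, one_mul]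
      · simp [Set.indicator, ha]

theorem IsSymmetric.lintegral_tilt_neg {x : Measure EReal} (hx : IsSymmetric x)
    {g : EReal → ℝ≥0∞} (hg : Measurable g) :
    ∫⁻ a, ENNReal.ofReal (1 - tau a) * g (-a) ∂x = ∫⁻ a, ENNReal.ofReal (1 - tau a) * g a ∂x := by
  have h := (isSymmetric_iff_map_tilt x).mp hx
  rw [← lintegral_tilt x hg, ← lintegral_tilt_comp_neg x hg]
  conv_rhs => rw [← h, lintegral_map hg measurable_neg]

theorem isSymmetric_of_lintegral {x : Measure EReal}
    (h : ∀ g : EReal → ℝ≥0∞, Measurable g →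
      ∫⁻ a, ENNReal.ofReal (1 - tau a) * g (-a) ∂x = ∫⁻ a, ENNReal.ofReal (1 - tau a) * g a ∂x) :
    IsSymmetric x := by
  rw [isSymmetric_iff_map_tilt]
  refine Measure.ext_of_lintegral _ fun g hg => ?_
  rw [lintegral_map hg measurable_neg, lintegral_tilt x hg,
      lintegral_tilt_comp_neg x hg]
  exact h g hg

/-- A nonnegative function has the same integral as its symmetrization. -/
theorem IsSymmetric.lintegral_eq {x : Measure EReal} (hx : IsSymmetric x) {g : EReal → ℝ≥0∞}
    (hg : Measurable g) :
    ∫⁻ a, g a ∂x = ∫⁻ a, (ENNReal.ofReal ((1 + tau a) / 2) * g a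
      + ENNReal.ofReal ((1 - tau a) / 2) * g (-a)) ∂x := by
  have h2 : ∀ t : ℝ, ENNReal.ofReal (t / 2) = ENNReal.ofReal t * 2⁻¹ := fun t => by
    rw [ENNReal.ofReal_div_of_pos two_pos, ENNReal.ofReal_ofNat]; rfl
  have h := hx.lintegral_tilt_neg hg
  rw [lintegral_add_left (by fun_prop)]
  have e1 : ∫⁻ a, ENNReal.ofReal ((1 - tau a) / 2) * g (-a) ∂x
      = ∫⁻ a, ENNReal.ofReal ((1 - tau a) / 2) * g a ∂x := by
    simp only [h2, mul_right_comm _ _ (g _)]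
    rw [lintegral_mul_const _ (by fun_prop), lintegral_mul_const _ (by fun_prop), h]
  rw [e1, ← lintegral_add_left (by fun_prop)]
  refine lintegral_congr fun a => ?_
  rw [← add_mul, ← ENNReal.ofReal_add (by linarith [neg_one_le_tau a])
    (by linarith [tau_le_one a])]
  ring_nf
  simp

/-- The bounded measurable functions. -/
def IsBddMeas {α : Type*} [MeasurableSpace α] (φ : α → ℝ) : Prop :=
  Measurable φ ∧ ∃ C, ∀ a, |φ a| ≤ C

namespace IsBddMeas

variable {α β : Type*} [MeasurableSpace α] [MeasurableSpace β] {φ ψ : α → ℝ}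

theorem integrable (h : IsBddMeas φ) (μ : Measure α) [IsFiniteMeasure μ] : Integrable φ μ := by
  obtain ⟨hm, C, hC⟩ := h
  exact Integrable.of_bound hm.aestronglyMeasurable C (ae_of_all _ hC)

theorem comp (h : IsBddMeas φ) {g : β → α} (hg : Measurable g) : IsBddMeas fun b => φ (g b) :=
  ⟨h.1.comp hg, h.2.imp fun _ hC _ => hC _⟩

theorem add (h : IsBddMeas φ) (h' : IsBddMeas ψ) : IsBddMeas fun a => φ a + ψ a := by
  obtain ⟨hm, C, hC⟩ := h
  obtain ⟨hm', C', hC'⟩ := h'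
  exact ⟨hm.add hm', C + C', fun a => (abs_add_le _ _).trans (add_le_add (hC a) (hC' a))⟩

theorem mul (h : IsBddMeas φ) (h' : IsBddMeas ψ) : IsBddMeas fun a => φ a * ψ a := by
  obtain ⟨hm, C, hC⟩ := h
  obtain ⟨hm', C', hC'⟩ := h'
  refine ⟨hm.mul hm', C * C', fun a => ?_⟩
  rw [abs_mul]
  exact mul_le_mul (hC a) (hC' a) (abs_nonneg _) ((abs_nonneg _).trans (hC a))

theorem const (c : ℝ) : IsBddMeas fun _ : α => c := ⟨measurable_const, |c|, fun _ => le_rfl⟩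

theorem integral_right {φ : α × β → ℝ} (h : IsBddMeas φ) (μ : Measure β) [IsProbabilityMeasure μ] :
    IsBddMeas fun a => ∫ b, φ (a, b) ∂μ := by
  obtain ⟨hm, C, hC⟩ := h
  refine ⟨(hm.stronglyMeasurable.integral_prod_right' (ν := μ)).measurable, C, fun a => ?_⟩
  have := norm_integral_le_of_norm_le_const (μ := μ) (f := fun b => φ (a, b)) (C := C)
    (ae_of_all _ fun b => hC _)
  simpa using this

end IsBddMeas

theorem isBddMeas_tau : IsBddMeas tau := ⟨measurable_tau, 1, abs_tau_le_one⟩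

theorem isBddMeas_tau_pow (n : ℕ) : IsBddMeas fun a => tau a ^ n :=
  ⟨by fun_prop, 1, fun a => by rw [abs_pow]; exact pow_le_one₀ (abs_nonneg _) (abs_tau_le_one a)⟩

/-- A bounded function has the same integral as its symmetrization. -/
theorem IsSymmetric.integral_eq {x : Measure EReal} [IsFiniteMeasure x] (hx : IsSymmetric x)
    {φ : EReal → ℝ} (hφ : IsBddMeas φ) :
    ∫ a, φ a ∂x = ∫ a, ((1 + tau a) / 2 * φ a + (1 - tau a) / 2 * φ (-a)) ∂x := by
  have h : ∀ ψ : EReal → ℝ, ∫ a, ψ a ∂tilt x = ∫ a, (1 - tau a) * ψ a ∂x := fun ψ => by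
    rw [tilt, integral_withDensity_eq_integral_toReal_smul (by fun_prop)
      (ae_of_all _ fun a => ENNReal.ofReal_lt_top)]
    refine integral_congr_ae (ae_of_all _ fun a => ?_)
    simp only [smul_eq_mul]
    rw [ENNReal.toReal_ofReal (by linarith [tau_le_one a])]
  -- Invariance of the tilted measure under negation.
  have h1 : ∫ a, (1 - tau a) * φ (-a) ∂x = ∫ a, (1 - tau a) * φ a ∂x := by
    rw [← h, ← h]
    conv_rhs => rw [← (isSymmetric_iff_map_tilt x).mp hx]
    rw [integral_map measurable_neg.aemeasurable hφ.1.aestronglyMeasurable]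
  have hb : IsBddMeas fun a => (1 - tau a) / 2 := by
    have := ((IsBddMeas.const 1).add ((IsBddMeas.const (-1)).mul isBddMeas_tau)).mul
      (IsBddMeas.const (2⁻¹ : ℝ))
    convert this using 2; ring
  have hb' : IsBddMeas fun a => (1 + tau a) / 2 := by
    have := ((IsBddMeas.const 1).add isBddMeas_tau).mul (IsBddMeas.const (2⁻¹ : ℝ))
    convert this using 2; ring
  rw [integral_add ((hb'.mul hφ).integrable x)
    ((hb.mul (hφ.comp measurable_neg)).integrable x)]
  have h2 : ∫ a, (1 - tau a) / 2 * φ (-a) ∂x = ∫ a, (1 - tau a) / 2 * φ a ∂x := by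
    simp only [div_mul_eq_mul_div, integral_div, h1]
  rw [h2, ← integral_add ((hb'.mul hφ).integrable x) ((hb.mul hφ).integrable x)]
  congr 1; ext a; ring

/-! ### Closure of the symmetric probability measures under the density evolution operations -/

theorem measurable_chk : Measurable fun p : EReal × EReal => tauInv (tau p.1 * tau p.2) :=
  measurable_tauInv.comp (by fun_prop)

instance isProbabilityMeasure_varOp (x y : Measure EReal) [IsProbabilityMeasure x]
    [IsProbabilityMeasure y] : IsProbabilityMeasure (varOp x y) :=
  inferInstanceAs (IsProbabilityMeasure (Measure.conv x y))

instance isProbabilityMeasure_chkOp (x y : Measure EReal) [IsProbabilityMeasure x]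
    [IsProbabilityMeasure y] : IsProbabilityMeasure (chkOp x y) :=
  Measure.isProbabilityMeasure_map measurable_chk.aemeasurable

instance : IsProbabilityMeasure deltaZero := inferInstanceAs (IsProbabilityMeasure (Measure.dirac _))

instance : IsProbabilityMeasure deltaInf := inferInstanceAs (IsProbabilityMeasure (Measure.dirac _))

theorem lintegral_varOp (x y : Measure EReal) [SFinite y] {g : EReal → ℝ≥0∞} (hg : Measurable g) :
    ∫⁻ a, g a ∂varOp x y = ∫⁻ a, ∫⁻ b, g (a + b) ∂y ∂x :=
  Measure.lintegral_conv hg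

theorem lintegral_chkOp (x y : Measure EReal) [SFinite y] {g : EReal → ℝ≥0∞} (hg : Measurable g) :
    ∫⁻ a, g a ∂chkOp x y = ∫⁻ a, ∫⁻ b, g (tauInv (tau a * tau b)) ∂y ∂x := by
  rw [chkOp, lintegral_map hg measurable_chk,
    lintegral_prod (fun p : EReal × EReal => g (tauInv (tau p.1 * tau p.2)))
      (hg.comp measurable_chk).aemeasurable]

theorem integral_varOp (x y : Measure EReal) [IsFiniteMeasure x] [IsFiniteMeasure y]
    {φ : EReal → ℝ} (hφ : IsBddMeas φ) :
    ∫ a, φ a ∂varOp x y = ∫ a, ∫ b, φ (a + b) ∂y ∂x := by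
  rw [varOp, Measure.conv, integral_map measurable_add.aemeasurable hφ.1.aestronglyMeasurable,
    integral_prod _ ((hφ.comp measurable_add).integrable _)]

theorem integral_chkOp (x y : Measure EReal) [IsFiniteMeasure x] [IsFiniteMeasure y]
    {φ : EReal → ℝ} (hφ : IsBddMeas φ) :
    ∫ a, φ a ∂chkOp x y = ∫ a, ∫ b, φ (tauInv (tau a * tau b)) ∂y ∂x := by
  rw [chkOp, integral_map measurable_chk.aemeasurable hφ.1.aestronglyMeasurable,
    integral_prod _ ((hφ.comp measurable_chk).integrable _)]

theorem ofReal_one_sub_tau_add {a b : EReal} (hb : b ≠ ⊥) (ha : a ≠ ⊥) :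
    ENNReal.ofReal (1 - tau (a + b)) = ENNReal.ofReal (1 - tau a) *
      (ENNReal.ofReal (1 - tau b) * (ENNReal.ofReal (1 + tau a * tau b))⁻¹) := by
  have h : 1 + tau a * tau b ≠ 0 := fun h => by
    rcases tau_mul_eq_neg_one h with ⟨_, h⟩ | ⟨h, _⟩
    exacts [hb h, ha h]
  have hpos : 0 < 1 + tau a * tau b := lt_of_le_of_ne (one_add_tau_mul_nonneg a b) h.symm
  rw [← ENNReal.ofReal_inv_of_pos hpos, ← ENNReal.ofReal_mul (by linarith [tau_le_one b]),
    ← ENNReal.ofReal_mul (by linarith [tau_le_one a]), one_add_mul_tau_add h]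
  congr 1
  field_simp
  ring

/-- By the addition theorem 1 - τ(a + b) = (1 - τ(a))(1 - τ(b)) / (1 + τ(a)τ(b)). The denominator is
unchanged when both variables change sign, so the two tilted measures can be reflected one after the
other. -/
theorem IsSymmetric.varOp {x y : Measure EReal} [SFinite x] [SFinite y] (hx : IsSymmetric x)
    (hy : IsSymmetric y) : IsSymmetric (varOp x y) := by
  refine isSymmetric_of_lintegral fun g hg => ?_
  rw [lintegral_varOp _ _ (g := fun a => ENNReal.ofReal (1 - tau a) * g (-a)) (by fun_prop),
    lintegral_varOp _ _ (g := fun a => ENNReal.ofReal (1 - tau a) * g a) (by fun_prop)]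
  have key : ∀ G : EReal → ℝ≥0∞, Measurable G →
      ∫⁻ a, ∫⁻ b, ENNReal.ofReal (1 - tau (a + b)) * G (a + b) ∂y ∂x =
      ∫⁻ a, ENNReal.ofReal (1 - tau a) * ∫⁻ b, ENNReal.ofReal (1 - tau b) *
        ((ENNReal.ofReal (1 + tau a * tau b))⁻¹ * G (a + b)) ∂y ∂x := fun G hG => by
    refine lintegral_congr_ae (hx.ae_ne_bot.mono fun a ha => ?_)
    simp only
    rw [← lintegral_const_mul _ (by fun_prop)]
    refine lintegral_congr_ae (hy.ae_ne_bot.mono fun b hb => ?_)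
    simp only
    rw [ofReal_one_sub_tau_add hb ha]
    ring
  rw [key _ hg, key (fun a => g (-a)) (by fun_prop)]
  have hm : Measurable fun p : EReal × EReal => ENNReal.ofReal (1 - tau p.2) *
      ((ENNReal.ofReal (1 + tau p.1 * tau p.2))⁻¹ * g (p.1 + p.2)) := by fun_prop
  rw [← hx.lintegral_tilt_neg hm.lintegral_prod_right']
  refine lintegral_congr_ae (hx.ae_ne_bot.mono fun a ha => ?_)
  simp only
  -- At ⊤ the weight 1 - τ vanishes; this removes the case where negation is not additive.
  by_cases ht : a = ⊤
  · simp [ht]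
  congr 1
  rw [← hy.lintegral_tilt_neg (by fun_prop)]
  refine lintegral_congr fun b => ?_
  rw [tau_neg, tau_neg, mul_neg, neg_mul, EReal.neg_add (.inl ha) (.inl ht),
    sub_eq_add_neg (-a), neg_neg]

/-- Write 1 - st = ((1 - s)(1 + t) + (1 + s)(1 - t))/2. In each summand, reflect the variable that
carries the weight 1 - τ: this changes the sign of the product st and leaves the other weight alone.
-/
theorem IsSymmetric.chkOp {x y : Measure EReal} [SFinite x] [SFinite y] (hx : IsSymmetric x)
    (hy : IsSymmetric y) : IsSymmetric (chkOp x y) := by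
  refine isSymmetric_of_lintegral fun g hg => ?_
  have m1 := measurable_chk
  rw [lintegral_chkOp _ _ (g := fun a => ENNReal.ofReal (1 - tau a) * g (-a)) (by fun_prop),
    lintegral_chkOp _ _ (g := fun a => ENNReal.ofReal (1 - tau a) * g a) (by fun_prop)]
  have h2 : ∀ t : ℝ, ENNReal.ofReal (t / 2) = 2⁻¹ * ENNReal.ofReal t := fun t => by
    rw [ENNReal.ofReal_div_of_pos two_pos, ENNReal.ofReal_ofNat, mul_comm]; rfl
  have key : ∀ G : EReal → ℝ≥0∞, Measurable G →
      ∫⁻ a, ∫⁻ b, ENNReal.ofReal (1 - tau (tauInv (tau a * tau b))) * G (tauInv (tau a * tau b)) ∂y ∂x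
      = 2⁻¹ * (∫⁻ a, ENNReal.ofReal (1 - tau a) *
          ∫⁻ b, ENNReal.ofReal (1 + tau b) * G (tauInv (tau a * tau b)) ∂y ∂x
        + ∫⁻ a, ENNReal.ofReal (1 + tau a) *
          ∫⁻ b, ENNReal.ofReal (1 - tau b) * G (tauInv (tau a * tau b)) ∂y ∂x) := fun G hG => by
    have n1 : Measurable fun p : EReal × EReal =>
      ENNReal.ofReal (1 + tau p.2) * G (tauInv (tau p.1 * tau p.2)) := by fun_prop
    have n2 : Measurable fun p : EReal × EReal =>
      ENNReal.ofReal (1 - tau p.2) * G (tauInv (tau p.1 * tau p.2)) := by fun_prop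
    have n1' := n1.lintegral_prod_right' (ν := y)
    have n2' := n2.lintegral_prod_right' (ν := y)
    have n1'' := fun a => n1.comp (measurable_prodMk_left (x := a))
    have n2'' := fun a => n2.comp (measurable_prodMk_left (x := a))
    simp only [Function.comp_def] at n1'' n2''
    rw [← lintegral_add_left (by fun_prop), ← lintegral_const_mul _ (by fun_prop)]
    refine lintegral_congr fun a => ?_
    have n4 : Measurable fun b =>
        ENNReal.ofReal (1 - tau a) * (ENNReal.ofReal (1 + tau b) * G (tauInv (tau a * tau b))) +
        ENNReal.ofReal (1 + tau a) * (ENNReal.ofReal (1 - tau b) * G (tauInv (tau a * tau b))) :=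
      ((n1'' a).const_mul _).add ((n2'' a).const_mul _)
    rw [← lintegral_const_mul _ (n1'' a), ← lintegral_const_mul _ (n2'' a),
      ← lintegral_add_left ((n1'' a).const_mul _),
      ← lintegral_const_mul _ n4]
    refine lintegral_congr fun b => ?_
    rw [← mul_assoc, ← mul_assoc, ← add_mul, ← mul_assoc,
      ← ENNReal.ofReal_mul (by linarith [tau_le_one a]),
      ← ENNReal.ofReal_mul (by linarith [neg_one_le_tau a]),
      ← ENNReal.ofReal_add (mul_nonneg (by linarith [tau_le_one a]) (by linarith [neg_one_le_tau b]))
        (mul_nonneg (by linarith [neg_one_le_tau a]) (by linarith [tau_le_one b])), ← h2,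
      tau_tauInv (abs_tau_mul_tau_le_one a b)]
    congr 2
    ring
  rw [key _ hg, key (fun a => g (-a)) (by fun_prop)]
  have hflip : ∀ a b : EReal, -tauInv (tau a * tau b) = tauInv (tau (-a) * tau b) := fun a b => by
    rw [tau_neg, neg_mul, tauInv_neg (abs_tau_mul_tau_le_one a b)]
  have hflip' : ∀ a b : EReal, -tauInv (tau a * tau b) = tauInv (tau a * tau (-b)) := fun a b => by
    rw [tau_neg, mul_neg, tauInv_neg (abs_tau_mul_tau_le_one a b)]
  congr 2
  · have hm : Measurable fun p : EReal × EReal => ENNReal.ofReal (1 + tau p.2) *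
      g (tauInv (tau p.1 * tau p.2)) := by fun_prop
    rw [← hx.lintegral_tilt_neg hm.lintegral_prod_right']
    simp only [hflip]
  · refine lintegral_congr fun a => ?_
    rw [← hy.lintegral_tilt_neg (g := fun b => g (tauInv (tau a * tau b)))
      ((hg.comp m1).comp (measurable_prodMk_left (x := a)))]
    simp only [hflip']

theorem varOp_mem {x y : Measure EReal} (hx : x ∈ symProb) (hy : y ∈ symProb) :
    varOp x y ∈ symProb := by
  have := hx.1
  have := hy.1
  exact ⟨inferInstance, hx.2.varOp hy.2⟩

theorem chkOp_mem {x y : Measure EReal} (hx : x ∈ symProb) (hy : y ∈ symProb) :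
    chkOp x y ∈ symProb := by
  have := hx.1
  have := hy.1
  exact ⟨inferInstance, hx.2.chkOp hy.2⟩

theorem deltaZero_mem : deltaZero ∈ symProb := by
  refine ⟨inferInstance, isSymmetric_of_lintegral fun g hg => ?_⟩
  rw [deltaZero, lintegral_dirac' _ (by fun_prop), lintegral_dirac' _ (by fun_prop)]
  simp

theorem deltaInf_mem : deltaInf ∈ symProb := by
  refine ⟨inferInstance, isSymmetric_of_lintegral fun g hg => ?_⟩
  rw [deltaInf, lintegral_dirac' _ (by fun_prop), lintegral_dirac' _ (by fun_prop)]
  simp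

theorem sum_smul_mem {ι : Type*} {s : Finset ι} {p : ι → ℝ≥0} {μ : ι → Measure EReal}
    (hp : ∑ i ∈ s, p i = 1) (hμ : ∀ i ∈ s, μ i ∈ symProb) : ∑ i ∈ s, p i • μ i ∈ symProb := by
  constructor
  · constructor
    rw [Measure.finsetSum_apply]
    calc ∑ i ∈ s, (p i • μ i) Set.univ = ∑ i ∈ s, (p i : ℝ≥0∞) :=
          Finset.sum_congr rfl fun i hi => by
            have := (hμ i hi).1
            rw [Measure.smul_apply, measure_univ, ENNReal.smul_def, smul_eq_mul, mul_one]
      _ = 1 := by rw [← ENNReal.ofNNReal_finsetSum, hp, ENNReal.coe_one]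
  · refine isSymmetric_of_lintegral fun g hg => ?_
    rw [lintegral_finsetSum_measure, lintegral_finsetSum_measure]
    refine Finset.sum_congr rfl fun i hi => ?_
    rw [lintegral_smul_measure, lintegral_smul_measure, (hμ i hi).2.lintegral_tilt_neg hg]

theorem sum_coeff_eq_eval_one (p : ℝ≥0[X]) : ∑ n ∈ p.support, p.coeff n = p.eval 1 := by
  rw [Polynomial.eval_eq_sum, Polynomial.sum]
  simp

theorem opPow_mem {op : Measure EReal → Measure EReal → Measure EReal} {e x : Measure EReal}
    (hop : ∀ {x y}, x ∈ symProb → y ∈ symProb → op x y ∈ symProb) (he : e ∈ symProb)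
    (hx : x ∈ symProb) (n : ℕ) : opPow op e x n ∈ symProb := by
  induction n with
  | zero => exact he
  | succ n ih => exact hop ih hx

theorem varPow_mem {x : Measure EReal} (hx : x ∈ symProb) (n : ℕ) :
    opPow varOp deltaZero x n ∈ symProb := opPow_mem varOp_mem deltaZero_mem hx n

theorem chkPow_mem {x : Measure EReal} (hx : x ∈ symProb) (n : ℕ) :
    opPow chkOp deltaInf x n ∈ symProb := opPow_mem chkOp_mem deltaInf_mem hx n

theorem varPoly_mem {p : ℝ≥0[X]} (hp : p.eval 1 = 1) {x : Measure EReal} (hx : x ∈ symProb) :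
    varPoly p x ∈ symProb :=
  sum_smul_mem ((sum_coeff_eq_eval_one p).trans hp) fun n _ => varPow_mem hx n

theorem chkPoly_mem {p : ℝ≥0[X]} (hp : p.eval 1 = 1) {x : Measure EReal} (hx : x ∈ symProb) :
    chkPoly p x ∈ symProb :=
  sum_smul_mem ((sum_coeff_eq_eval_one p).trans hp) fun n _ => chkPow_mem hx n

theorem average_eq (w : ℕ) (f : ℕ → Measure EReal) :
    average w f = ∑ k ∈ Finset.range w, (w : ℝ≥0)⁻¹ • f k := Finset.smul_sum

theorem average_mem {w : ℕ} (hw : 0 < w) {f : ℕ → Measure EReal} (hf : ∀ k, f k ∈ symProb) :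
    average w f ∈ symProb := by
  rw [average_eq]
  refine sum_smul_mem ?_ fun k _ => hf k
  rw [Finset.sum_const, Finset.card_range, nsmul_eq_mul, mul_inv_cancel₀]
  exact_mod_cast hw.ne'

theorem integral_sum_smul {ι : Type*} {s : Finset ι} {p : ι → ℝ≥0} {μ : ι → Measure EReal}
    (hμ : ∀ i ∈ s, μ i ∈ symProb) {φ : EReal → ℝ} (hφ : IsBddMeas φ) :
    ∫ a, φ a ∂(∑ i ∈ s, p i • μ i) = ∑ i ∈ s, (p i : ℝ) * ∫ a, φ a ∂μ i := by
  rw [integral_finsetSum_measure]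
  · refine Finset.sum_congr rfl fun i hi => ?_
    rw [integral_smul_nnreal_measure]; rfl
  · intro i hi
    have := (hμ i hi).1
    exact hφ.integrable _

theorem integral_varPoly (p : ℝ≥0[X]) {x : Measure EReal} (hx : x ∈ symProb) {φ : EReal → ℝ}
    (hφ : IsBddMeas φ) : ∫ a, φ a ∂varPoly p x =
      ∑ n ∈ p.support, (p.coeff n : ℝ) * ∫ a, φ a ∂opPow varOp deltaZero x n :=
  integral_sum_smul (fun n _ => varPow_mem hx n) hφ

theorem integral_chkPoly (p : ℝ≥0[X]) {x : Measure EReal} (hx : x ∈ symProb) {φ : EReal → ℝ}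
    (hφ : IsBddMeas φ) : ∫ a, φ a ∂chkPoly p x =
      ∑ n ∈ p.support, (p.coeff n : ℝ) * ∫ a, φ a ∂opPow chkOp deltaInf x n :=
  integral_sum_smul (fun n _ => chkPow_mem hx n) hφ

theorem integral_average (w : ℕ) {f : ℕ → Measure EReal} (hf : ∀ k, f k ∈ symProb)
    {φ : EReal → ℝ} (hφ : IsBddMeas φ) : ∫ a, φ a ∂average w f =
      (w : ℝ)⁻¹ * ∑ k ∈ Finset.range w, ∫ a, φ a ∂f k := by
  rw [average_eq, integral_sum_smul (fun k _ => hf k) hφ, Finset.mul_sum]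
  simp

/-! ### The entropy kernel -/

/-- The function `e` with `H(x) = ∫ e(τ) dx` for symmetric `x`: the binary entropy of
`(1 - s) / 2`. -/
def entKernel (s : ℝ) : ℝ :=
  1 + (Real.negMulLog (1 + s) + Real.negMulLog (1 - s)) / (2 * Real.log 2)

@[fun_prop] theorem continuous_entKernel : Continuous entKernel := by
  unfold entKernel; fun_prop

theorem entKernel_neg (s : ℝ) : entKernel (-s) = entKernel s := by
  unfold entKernel; rw [sub_neg_eq_add, ← sub_eq_add_neg, add_comm (Real.negMulLog (1 - s))]

theorem entKernel_abs (s : ℝ) : entKernel |s| = entKernel s := by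
  rcases abs_choice s with h | h <;> rw [h]
  exact entKernel_neg s

theorem log_two_ne_zero : Real.log 2 ≠ 0 := (Real.log_pos one_lt_two).ne'

@[simp] theorem entKernel_one : entKernel 1 = 0 := by
  have := log_two_ne_zero
  unfold entKernel
  norm_num [Real.negMulLog]

/-- The partial fractions match the power series of s log((1 + s)/(1 - s)) and of log(1 - s²). -/
theorem gammaCoeff_succ (k : ℕ) :
    gammaCoeff (k + 1) = (2 * Real.log 2)⁻¹ * (2 * (1 / (2 * (k : ℝ) + 1)) - 1 / ((k : ℝ) + 1)) := by
  have := log_two_ne_zero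
  unfold gammaCoeff
  push_cast
  have h1 : (2 * (k : ℝ) + 1) ≠ 0 := by positivity
  have h2 : ((k : ℝ) + 1) ≠ 0 := by positivity
  have h3 : 2 * ((k : ℝ) + 1) - 1 ≠ 0 := by
    convert h1 using 1; ring
  field_simp
  ring

theorem gammaCoeff_succ_nonneg (k : ℕ) : 0 ≤ gammaCoeff (k + 1) := by
  unfold gammaCoeff
  push_cast
  have := Real.log_pos one_lt_two
  have : (0 : ℝ) ≤ 2 * ((k : ℝ) + 1) - 1 := by linarith [k.cast_nonneg (α := ℝ)]
  positivity

theorem gammaCoeff_succ_pos (k : ℕ) : 0 < gammaCoeff (k + 1) := by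
  unfold gammaCoeff
  push_cast
  have := Real.log_pos one_lt_two
  have : (0 : ℝ) < 2 * ((k : ℝ) + 1) - 1 := by linarith [k.cast_nonneg (α := ℝ)]
  positivity

theorem summable_gammaCoeff : Summable fun k : ℕ => gammaCoeff (k + 1) := by
  have h := ((summable_nat_add_iff 1).mpr
    (Real.summable_one_div_nat_pow.mpr one_lt_two)).mul_left (Real.log 2)⁻¹
  refine Summable.of_nonneg_of_le gammaCoeff_succ_nonneg (fun k => ?_) h
  unfold gammaCoeff
  rw [div_eq_mul_one_div]
  have h2 := Real.log_pos one_lt_two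
  have h0 := k.cast_nonneg (α := ℝ)
  push_cast
  gcongr
  nlinarith

theorem hasSum_gammaCoeff_of_abs_lt_one {s : ℝ} (hs : |s| < 1) :
    HasSum (fun k : ℕ => gammaCoeff (k + 1) * s ^ (2 * (k + 1))) (1 - entKernel s) := by
  have hs' := abs_lt.mp hs
  have h1 := Real.hasSum_pow_div_log_of_abs_lt_one (x := s ^ 2) (by
    rw [abs_pow]; exact pow_lt_one₀ (abs_nonneg s) hs two_ne_zero)
  have h2 := (Real.hasSum_log_sub_log_of_abs_lt_one hs).mul_left s
  have h3 := (h2.sub h1).mul_left (2 * Real.log 2)⁻¹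
  have h4 : 1 - entKernel s = (2 * Real.log 2)⁻¹ *
      (s * (Real.log (1 + s) - Real.log (1 - s)) - -Real.log (1 - s ^ 2)) := by
    rw [show 1 - s ^ 2 = (1 + s) * (1 - s) by ring, Real.log_mul (by linarith) (by linarith)]
    unfold entKernel Real.negMulLog
    have := log_two_ne_zero
    field_simp
    ring
  have h5 : ∀ k : ℕ, gammaCoeff (k + 1) * s ^ (2 * (k + 1)) = (2 * Real.log 2)⁻¹ *
      (s * (2 * (1 / (2 * (k : ℝ) + 1)) * s ^ (2 * k + 1)) - (s ^ 2) ^ (k + 1) / ((k : ℝ) + 1)) :=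
    fun k => by rw [gammaCoeff_succ]; ring
  simp only [h4, h5]
  exact h3

/-- The series converges uniformly on [-1, 1] because the coefficients are summable, so the identity
extends from the open interval by continuity. The endpoint s = 1 shows that the weights add up to
one. -/
theorem tsum_gammaCoeff_mul_pow {s : ℝ} (hs : |s| ≤ 1) :
    ∑' k : ℕ, gammaCoeff (k + 1) * s ^ (2 * (k + 1)) = 1 - entKernel s := by
  have hc : ContinuousOn (fun s : ℝ => ∑' k : ℕ, gammaCoeff (k + 1) * s ^ (2 * (k + 1)))
      (Set.Icc (-1) 1) := by
    refine continuousOn_tsum (fun k => by fun_prop) summable_gammaCoeff fun k s hs => ?_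
    rw [norm_mul, Real.norm_of_nonneg (gammaCoeff_succ_nonneg k), norm_pow, Real.norm_eq_abs]
    exact mul_le_of_le_one_right (gammaCoeff_succ_nonneg k)
      (pow_le_one₀ (abs_nonneg s) (abs_le.mpr hs))
  have heq : Set.EqOn (fun s : ℝ => ∑' k : ℕ, gammaCoeff (k + 1) * s ^ (2 * (k + 1)))
      (fun s => 1 - entKernel s) (Set.Ioo (-1) 1) := fun s hs =>
    (hasSum_gammaCoeff_of_abs_lt_one (abs_lt.mpr hs)).tsum_eq
  exact heq.of_subset_closure hc (by fun_prop) Set.Ioo_subset_Icc_self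
    (by rw [closure_Ioo (by norm_num)]) (abs_le.mp hs)

theorem tsum_gammaCoeff : ∑' k : ℕ, gammaCoeff (k + 1) = 1 := by
  have h := tsum_gammaCoeff_mul_pow (s := 1) (by simp)
  simpa using h

/-- The probability weights `γ_{k+1}` on the natural numbers. -/
def gammaPMF : PMF ℕ :=
  ⟨fun k => ENNReal.ofReal (gammaCoeff (k + 1)), by
    rw [ENNReal.summable.hasSum_iff,
      ← ENNReal.ofReal_tsum_of_nonneg gammaCoeff_succ_nonneg summable_gammaCoeff, tsum_gammaCoeff,
      ENNReal.ofReal_one]⟩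

/-- The probability measure `∑_k γ_{k+1} δ_k` on the natural numbers. -/
abbrev gammaMeas : Measure ℕ := gammaPMF.toMeasure

theorem IsBddMeas.integral_gammaMeas {f : ℕ → ℝ} (hf : IsBddMeas f) :
    ∫ k, f k ∂gammaMeas = ∑' k, gammaCoeff (k + 1) * f k := by
  rw [PMF.integral_eq_tsum _ _ (hf.integrable _)]
  refine tsum_congr fun k => ?_
  rw [smul_eq_mul]
  congr 1
  exact ENNReal.toReal_ofReal (gammaCoeff_succ_nonneg k)

theorem isBddMeas_pow_nat {s : ℝ} (hs : |s| ≤ 1) : IsBddMeas fun k : ℕ => s ^ (2 * (k + 1)) :=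
  ⟨.of_discrete, 1, fun k => by rw [abs_pow]; exact pow_le_one₀ (abs_nonneg s) hs⟩

/-- Writing the series as an integral against a probability measure makes Fubini and monotonicity of
integrals available. -/
theorem entKernel_eq_integral {s : ℝ} (hs : |s| ≤ 1) :
    entKernel s = ∫ k : ℕ, (1 - s ^ (2 * (k + 1))) ∂gammaMeas := by
  rw [integral_sub ((IsBddMeas.const 1).integrable _) ((isBddMeas_pow_nat hs).integrable _),
    (isBddMeas_pow_nat hs).integral_gammaMeas, tsum_gammaCoeff_mul_pow hs]
  simp

theorem entKernel_nonneg {s : ℝ} (hs : |s| ≤ 1) : 0 ≤ entKernel s := by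
  rw [entKernel_eq_integral hs]
  refine integral_nonneg fun k => sub_nonneg.mpr ?_
  rw [← abs_of_nonneg (Even.pow_nonneg (even_two_mul (k + 1)) s), abs_pow]
  exact pow_le_one₀ (abs_nonneg s) hs

theorem entKernel_le_one {s : ℝ} (hs : |s| ≤ 1) : entKernel s ≤ 1 := by
  rw [entKernel_eq_integral hs]
  calc _ ≤ ∫ _, (1 : ℝ) ∂gammaMeas := by
        refine integral_mono_of_nonneg (ae_of_all _ fun k => sub_nonneg.mpr ?_)
          ((IsBddMeas.const 1).integrable _) (ae_of_all _ fun k => sub_le_self _ ?_)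
        · rw [← abs_of_nonneg (Even.pow_nonneg (even_two_mul (k + 1)) s), abs_pow]
          exact pow_le_one₀ (abs_nonneg s) hs
        · exact Even.pow_nonneg (even_two_mul (k + 1)) s
    _ = 1 := by simp

theorem isBddMeas_entKernel : IsBddMeas fun a => entKernel (tau a) :=
  ⟨by fun_prop, 1, fun a => by
    rw [abs_of_nonneg (entKernel_nonneg (abs_tau_le_one a))]
    exact entKernel_le_one (abs_tau_le_one a)⟩

/-- The addition formula of the entropy kernel, which underlies the duality rule. -/
theorem entKernel_add {s t : ℝ} :
    (1 + s * t) / 2 * entKernel ((s + t) / (1 + s * t))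
      + (1 - s * t) / 2 * entKernel ((s - t) / (1 - s * t))
      = entKernel s + entKernel t - entKernel (s * t) ∨ 1 + s * t = 0 ∨ 1 - s * t = 0 := by
  by_cases h1 : 1 + s * t = 0
  · exact .inr (.inl h1)
  by_cases h2 : 1 - s * t = 0
  · exact .inr (.inr h2)
  refine .inl ?_
  -- Clearing the denominator d leaves -2 negMulLog d; for d = 1 ± st these terms assemble to the
  -- kernel at st. The remaining arguments d ± v factor as (1 ± s)(1 ± t), where `negMulLog` splits.
  have half : ∀ {v d : ℝ}, d ≠ 0 → d * (Real.negMulLog (1 + v / d) + Real.negMulLog (1 - v / d)) =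
      Real.negMulLog (d + v) + Real.negMulLog (d - v) - 2 * Real.negMulLog d := by
    intro v d hd
    have e1 := Real.negMulLog_mul d (1 + v / d)
    have e2 := Real.negMulLog_mul d (1 - v / d)
    rw [show d * (1 + v / d) = d + v by field_simp] at e1
    rw [show d * (1 - v / d) = d - v by field_simp] at e2
    rw [e1, e2]; ring
  have e1 := half (v := s + t) h1
  have e2 := half (v := s - t) h2
  have m1 := Real.negMulLog_mul (1 + s) (1 + t)
  have m2 := Real.negMulLog_mul (1 - s) (1 - t)
  have m3 := Real.negMulLog_mul (1 + s) (1 - t)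
  have m4 := Real.negMulLog_mul (1 - s) (1 + t)
  rw [show 1 + s * t + (s + t) = (1 + s) * (1 + t) by ring,
    show 1 + s * t - (s + t) = (1 - s) * (1 - t) by ring, m1, m2] at e1
  rw [show 1 - s * t + (s - t) = (1 + s) * (1 - t) by ring,
    show 1 - s * t - (s - t) = (1 - s) * (1 + t) by ring, m3, m4] at e2
  have := log_two_ne_zero
  unfold entKernel
  generalize Real.negMulLog (1 + (s + t) / (1 + s * t)) = A1 at *
  generalize Real.negMulLog (1 - (s + t) / (1 + s * t)) = A2 at *
  generalize Real.negMulLog (1 + (s - t) / (1 - s * t)) = A3 at *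
  generalize Real.negMulLog (1 - (s - t) / (1 - s * t)) = A4 at *
  field_simp
  linear_combination e1 + e2

/-! ### Moments and entropy of symmetric measures -/

theorem tanhMoment_nonneg (k : ℕ) (x : Measure EReal) : 0 ≤ tanhMoment k x :=
  integral_nonneg fun a => Even.pow_nonneg (even_two_mul k) (tau a)

theorem tau_pow_le_one (k : ℕ) (a : EReal) : tau a ^ (2 * k) ≤ 1 := by
  rw [← abs_of_nonneg (Even.pow_nonneg (even_two_mul k) (tau a)), abs_pow]
  exact pow_le_one₀ (abs_nonneg _) (abs_tau_le_one a)

theorem tanhMoment_le_one (k : ℕ) (x : Measure EReal) [IsProbabilityMeasure x] :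
    tanhMoment k x ≤ 1 := by
  calc tanhMoment k x ≤ ∫ _, (1 : ℝ) ∂x :=
        integral_mono ((isBddMeas_tau_pow _).integrable x) ((IsBddMeas.const 1).integrable x)
          (tau_pow_le_one k)
    _ = 1 := by simp

@[simp] theorem tanhMoment_deltaInf (k : ℕ) : tanhMoment k deltaInf = 1 := by
  rw [tanhMoment, deltaInf, integral_dirac]; simp

theorem tanhMoment_chkOp (k : ℕ) (x y : Measure EReal) [IsFiniteMeasure x] [IsFiniteMeasure y] :
    tanhMoment k (chkOp x y) = tanhMoment k x * tanhMoment k y := by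
  rw [tanhMoment, integral_chkOp x y (isBddMeas_tau_pow _)]
  simp only [tau_tauInv (abs_tau_mul_tau_le_one _ _), mul_pow, integral_const_mul,
    integral_mul_const]
  rfl

theorem tanhMoment_chkPow (k : ℕ) {x : Measure EReal} (hx : x ∈ symProb) (n : ℕ) :
    tanhMoment k (opPow chkOp deltaInf x n) = tanhMoment k x ^ n := by
  induction n with
  | zero => simp [opPow]
  | succ n ih =>
    have := (chkPow_mem hx n).1
    have := hx.1
    rw [opPow, tanhMoment_chkOp, ih, pow_succ]

/-- The value of the polynomial `p` with nonnegative coefficients at a real number. -/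
def evalReal (p : ℝ≥0[X]) (t : ℝ) : ℝ := ∑ n ∈ p.support, (p.coeff n : ℝ) * t ^ n

theorem tanhMoment_chkPoly (k : ℕ) (p : ℝ≥0[X]) {x : Measure EReal} (hx : x ∈ symProb) :
    tanhMoment k (chkPoly p x) = evalReal p (tanhMoment k x) := by
  rw [tanhMoment, integral_chkPoly p hx (isBddMeas_tau_pow _)]
  exact Finset.sum_congr rfl fun n _ => by rw [← tanhMoment_chkPow k hx n]; rfl

theorem tanhMoment_average (k w : ℕ) {f : ℕ → Measure EReal} (hf : ∀ k, f k ∈ symProb) :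
    tanhMoment k (average w f) = (w : ℝ)⁻¹ * ∑ j ∈ Finset.range w, tanhMoment k (f j) :=
  integral_average w hf (isBddMeas_tau_pow _)

theorem isBddMeas_tanhMoment {x : Measure EReal} (hx : x ∈ symProb) :
    IsBddMeas fun k : ℕ => tanhMoment (k + 1) x := by
  have := hx.1
  refine ⟨.of_discrete, 1, fun k => ?_⟩
  rw [abs_of_nonneg (tanhMoment_nonneg _ _)]
  exact tanhMoment_le_one _ _

theorem IsBddMeas.sub {α : Type*} [MeasurableSpace α] {φ ψ : α → ℝ} (h : IsBddMeas φ)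
    (h' : IsBddMeas ψ) : IsBddMeas fun a => φ a - ψ a := by
  simpa [sub_eq_add_neg] using h.add ((IsBddMeas.const (-1)).mul h')

/-- Since 1 + e^{-α} = 2/(1 + τ), averaging the integrand over ±α with the weights (1 ± τ)/2 gives
the binary entropy. The integrand is unbounded as α → -∞, so the symmetrization is done with
`lintegral`. -/
theorem entropy_eq_integral_entKernel {x : Measure EReal} (hx : x ∈ symProb) :
    entropy x = ∫ a, entKernel (tau a) ∂x := by
  have := hx.1
  have hg : Measurable fun a : EReal => Real.logb 2 (1 + (EReal.exp (-a)).toReal) := by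
    unfold Real.logb; fun_prop
  have hg0 : ∀ a : EReal, 0 ≤ Real.logb 2 (1 + (EReal.exp (-a)).toReal) := fun a =>
    Real.logb_nonneg one_lt_two (by linarith [ENNReal.toReal_nonneg (a := EReal.exp (-a))])
  rw [entropy, integral_eq_lintegral_of_nonneg_ae (ae_of_all _ hg0) hg.aestronglyMeasurable,
    integral_eq_lintegral_of_nonneg_ae (ae_of_all _ fun a => entKernel_nonneg (abs_tau_le_one a))
      isBddMeas_entKernel.1.aestronglyMeasurable, hx.2.lintegral_eq (by fun_prop)]
  congr 1
  refine lintegral_congr fun a => ?_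
  rw [← ENNReal.ofReal_mul (by linarith [neg_one_le_tau a]),
    ← ENNReal.ofReal_mul (by linarith [tau_le_one a]),
    ← ENNReal.ofReal_add (mul_nonneg (by linarith [neg_one_le_tau a]) (hg0 _))
      (mul_nonneg (by linarith [tau_le_one a]) (hg0 _))]
  congr 1
  induction a with
  | bot => rw [tau_bot, entKernel_neg]; simp
  | top => rw [tau_top]; simp
  | coe a =>
    have key : ∀ a : ℝ, Real.logb 2 (1 + (EReal.exp (-(a : EReal))).toReal) =
        1 - Real.log (1 + tau a) / Real.log 2 := fun a => by
      have h1 : (0 : ℝ) < 1 + tau a := by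
        rw [tau_coe]; linarith [Real.neg_one_lt_tanh (a / 2)]
      have h2 := congrArg ENNReal.toReal (exp_neg_mul_one_add_tau (EReal.coe_ne_bot a))
      rw [ENNReal.toReal_mul, ENNReal.toReal_ofReal h1.le,
        ENNReal.toReal_ofReal (by linarith [tau_le_one a])] at h2
      have h3 : 1 + (EReal.exp (-(a : EReal))).toReal = 2 / (1 + tau a) := by
        field_simp
        linarith
      rw [h3, Real.logb, Real.log_div two_ne_zero h1.ne', sub_div, div_self log_two_ne_zero]
    have h := key (-a)
    rw [EReal.coe_neg, tau_neg] at h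
    rw [key, h, entKernel, Real.negMulLog, Real.negMulLog, ← sub_eq_add_neg]
    have := log_two_ne_zero
    field_simp
    ring

/-- Fubini. From here on entropy inequalities can be proved separately for each moment. -/
theorem entropy_eq_integral {x : Measure EReal} (hx : x ∈ symProb) :
    entropy x = ∫ k : ℕ, (1 - tanhMoment (k + 1) x) ∂gammaMeas := by
  have := hx.1
  rw [entropy_eq_integral_entKernel hx]
  simp only [entKernel_eq_integral (abs_tau_le_one _)]
  have hb : IsBddMeas fun p : EReal × ℕ => 1 - tau p.1 ^ (2 * (p.2 + 1)) :=
    (IsBddMeas.const 1).sub ⟨measurable_from_prod_countable_left fun k => by fun_prop, 1,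
      fun p => by
        rw [abs_pow]; exact pow_le_one₀ (abs_nonneg _) (abs_tau_le_one _)⟩
  rw [integral_integral_swap (hb.integrable _)]
  refine integral_congr_ae (ae_of_all _ fun k => ?_)
  simp only
  rw [integral_sub ((IsBddMeas.const 1).integrable _) ((isBddMeas_tau_pow _).integrable _)]
  simp [tanhMoment]

/-- All moments of Δ_∞ take the maximal value 1, so every absolute value has a known sign. -/
theorem entropyDist_deltaInf {x : Measure EReal} (hx : x ∈ symProb) :
    entropyDist x deltaInf = entropy x := by
  have := hx.1
  rw [entropy_eq_integral hx,
    ((IsBddMeas.const 1).sub (isBddMeas_tanhMoment hx)).integral_gammaMeas]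
  refine tsum_congr fun k => ?_
  rw [tanhMoment_deltaInf, abs_sub_comm, abs_of_nonneg (sub_nonneg.mpr (tanhMoment_le_one _ _))]

theorem entropy_nonneg {x : Measure EReal} (hx : x ∈ symProb) : 0 ≤ entropy x := by
  have := hx.1
  rw [entropy_eq_integral hx]
  exact integral_nonneg fun k => sub_nonneg.mpr (tanhMoment_le_one _ _)

theorem entropy_mono {x y : Measure EReal} (hx : x ∈ symProb) (hy : y ∈ symProb)
    (h : ∀ k, tanhMoment k y ≤ tanhMoment k x) : entropy x ≤ entropy y := by
  rw [entropy_eq_integral hx, entropy_eq_integral hy]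
  refine integral_mono (((IsBddMeas.const 1).sub (isBddMeas_tanhMoment hx)).integrable _)
    (((IsBddMeas.const 1).sub (isBddMeas_tanhMoment hy)).integrable _) fun k => ?_
  exact sub_le_sub_left (h _) _

theorem entropy_le_one {x : Measure EReal} (hx : x ∈ symProb) : entropy x ≤ 1 := by
  rw [entropy_eq_integral hx]
  calc _ ≤ ∫ _, (1 : ℝ) ∂gammaMeas := by
        refine integral_mono (((IsBddMeas.const 1).sub (isBddMeas_tanhMoment hx)).integrable _)
          ((IsBddMeas.const 1).integrable _) fun k => sub_le_self _ (tanhMoment_nonneg _ _)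
    _ = 1 := by simp

/-- The first term of the series already suffices: it forces ∫ τ² = 1, so τ = ±1 almost surely, and
symmetry gives no mass to ⊥. -/
theorem eq_deltaInf_of_entropy_eq_zero {x : Measure EReal} (hx : x ∈ symProb)
    (h : entropy x = 0) : x = deltaInf := by
  have := hx.1
  have h0 : ∀ a : EReal, 0 ≤ 1 - tau a ^ (2 * (0 + 1)) := fun a =>
    sub_nonneg.mpr (tau_pow_le_one _ a)
  have hle : gammaCoeff (0 + 1) * (1 - tanhMoment (0 + 1) x) ≤ 0 := by
    have hb := (IsBddMeas.const 1).sub (isBddMeas_tanhMoment hx)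
    rw [← h, entropy_eq_integral hx, hb.integral_gammaMeas]
    refine Summable.le_tsum (f := fun k => gammaCoeff (k + 1) * (1 - tanhMoment (k + 1) x)) ?_ 0
      fun k _ => mul_nonneg (gammaCoeff_succ_nonneg k) (sub_nonneg.mpr (tanhMoment_le_one _ _))
    refine Summable.of_nonneg_of_le
      (fun k => mul_nonneg (gammaCoeff_succ_nonneg k) (sub_nonneg.mpr (tanhMoment_le_one _ _)))
      (fun k => mul_le_of_le_one_right (gammaCoeff_succ_nonneg k)
        (sub_le_self _ (tanhMoment_nonneg _ _))) summable_gammaCoeff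
  have h1 : tanhMoment 1 x = 1 := by
    have := nonpos_of_mul_nonpos_right hle (gammaCoeff_succ_pos 0)
    exact le_antisymm (tanhMoment_le_one _ _) (by simpa using this)
  have h2 : ∫ a, (1 - tau a ^ (2 * (0 + 1))) ∂x = 0 := by
    rw [integral_sub ((IsBddMeas.const 1).integrable _) ((isBddMeas_tau_pow _).integrable _)]
    have : ∫ a, tau a ^ (2 * (0 + 1)) ∂x = 1 := h1
    rw [this]; simp
  rw [integral_eq_zero_iff_of_nonneg h0
    (((IsBddMeas.const 1).sub (isBddMeas_tau_pow _)).integrable _)] at h2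
  have h3 : ∀ᵐ a ∂x, a = ⊤ := by
    filter_upwards [h2, hx.2.ae_ne_bot] with a ha hb
    have ha' : tau a * tau a = 1 := by
      have : 1 - tau a ^ (2 * (0 + 1)) = 0 := ha
      rw [zero_add, mul_one, sq] at this
      linarith
    rcases mul_self_eq_one_iff.mp ha' with h | h
    · exact tau_eq_one_iff.mp h
    · exact absurd (tau_eq_neg_one_iff.mp h) hb
  calc x = x.map id := Measure.map_id.symm
    _ = x.map fun _ => ⊤ := Measure.map_congr h3
    _ = deltaInf := by rw [Measure.map_const]; simp [deltaInf]

/-! ### The duality rule -/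

/-- Two-variable symmetrization. -/
theorem integral_integral_symmetrize {x y : Measure EReal} (hx : x ∈ symProb) (hy : y ∈ symProb)
    {G : EReal × EReal → ℝ} (hG : IsBddMeas G) (hneg : ∀ a b, G (-a, -b) = G (a, b)) :
    ∫ a, ∫ b, G (a, b) ∂y ∂x = ∫ a, ∫ b, ((1 + tau a * tau b) / 2 * G (a, b)
      + (1 - tau a * tau b) / 2 * G (a, -b)) ∂y ∂x := by
  have := hx.1
  have := hy.1
  have hneg' : ∀ a b, G (-a, b) = G (a, -b) := fun a b => by rw [← hneg, neg_neg]
  -- Symmetrize in `a`, rewrite G(-a, b) as G(a, -b), then symmetrize in `b`. The equal-sign weights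
  -- add up to (1 + τ(a)τ(b))/2 and the opposite-sign ones to (1 - τ(a)τ(b))/2.
  rw [hx.2.integral_eq (hG.integral_right y)]
  refine integral_congr_ae (ae_of_all _ fun a => ?_)
  simp only [hneg']
  have i1 : IsBddMeas fun b => G (a, b) := hG.comp measurable_prodMk_left
  have i2 : IsBddMeas fun b => G (a, -b) := i1.comp measurable_neg
  have j1 : IsBddMeas fun b => (1 + tau a) / 2 * G (a, b) := (IsBddMeas.const _).mul i1
  have j2 : IsBddMeas fun b => (1 - tau a) / 2 * G (a, -b) := (IsBddMeas.const _).mul i2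
  rw [← integral_const_mul, ← integral_const_mul,
    ← integral_add (j1.integrable _) (j2.integrable _), hy.2.integral_eq (j1.add j2)]
  refine integral_congr_ae (ae_of_all _ fun b => ?_)
  simp only [neg_neg]
  ring

/-- The weight vanishes exactly where the addition theorem fails. -/
theorem one_add_mul_abs_tau_add (F : ℝ → ℝ) (a b : EReal) :
    (1 + tau a * tau b) / 2 * F |tau (a + b)|
      = (1 + tau a * tau b) / 2 * F |(tau a + tau b) / (1 + tau a * tau b)| := by
  by_cases h : 1 + tau a * tau b = 0
  · simp [h]
  · rw [one_add_mul_tau_add h]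

theorem one_sub_mul_abs_tau_add_neg (F : ℝ → ℝ) (a b : EReal) :
    (1 - tau a * tau b) / 2 * F |tau (a + -b)|
      = (1 - tau a * tau b) / 2 * F |(tau a - tau b) / (1 - tau a * tau b)| := by
  have h := one_add_mul_abs_tau_add F a (-b)
  rwa [tau_neg, mul_neg, ← sub_eq_add_neg (1 : ℝ), ← sub_eq_add_neg (tau a)] at h

theorem integral_varOp_symmetrize {x y : Measure EReal} (hx : x ∈ symProb) (hy : y ∈ symProb)
    {F : ℝ → ℝ} (hF : IsBddMeas fun a => F |tau a|) :
    ∫ a, F |tau a| ∂varOp x y = ∫ a, ∫ b, ((1 + tau a * tau b) / 2 *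
        F |(tau a + tau b) / (1 + tau a * tau b)|
      + (1 - tau a * tau b) / 2 * F |(tau a - tau b) / (1 - tau a * tau b)|) ∂y ∂x := by
  have := hx.1
  have := hy.1
  rw [integral_varOp x y hF, integral_integral_symmetrize hx hy
    (G := fun p : EReal × EReal => F |tau (p.1 + p.2)|) (hF.comp measurable_add)
    fun a b => by simp only [abs_tau_neg_add_neg]]
  simp only [one_add_mul_abs_tau_add, one_sub_mul_abs_tau_add_neg]

/-- The duality rule between the two operations. -/
theorem entropy_varOp_add_entropy_chkOp {x y : Measure EReal} (hx : x ∈ symProb)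
    (hy : y ∈ symProb) : entropy (varOp x y) + entropy (chkOp x y) = entropy x + entropy y := by
  have := hx.1
  have := hy.1
  have hF : IsBddMeas fun a => entKernel |tau a| := by
    simpa only [entKernel_abs] using isBddMeas_entKernel
  have h1 : entropy (varOp x y) = ∫ a, ∫ b, (entKernel (tau a) + entKernel (tau b)
      - entKernel (tau a * tau b)) ∂y ∂x := by
    rw [entropy_eq_integral_entKernel (varOp_mem hx hy)]
    simp only [← entKernel_abs (tau _)]
    rw [integral_varOp_symmetrize hx hy hF]
    refine integral_congr_ae (ae_of_all _ fun a => integral_congr_ae (ae_of_all _ fun b => ?_))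
    simp only [entKernel_abs]
    -- In the two degenerate cases both values of τ are ±1, where the kernel is zero.
    rcases entKernel_add (s := tau a) (t := tau b) with h | h | h
    · exact h
    · rcases tau_mul_eq_neg_one h with ⟨rfl, rfl⟩ | ⟨rfl, rfl⟩ <;> norm_num [entKernel_neg]
    · have h' : 1 + tau a * tau (-b) = 0 := by rw [tau_neg]; linarith
      rcases tau_mul_eq_neg_one h' with ⟨rfl, hb⟩ | ⟨rfl, hb⟩
      · obtain rfl : b = ⊤ := by simpa using hb
        simp
      · obtain rfl : b = ⊥ := by simpa using hb
        norm_num [entKernel_neg]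
  have h2 : entropy (chkOp x y) = ∫ a, ∫ b, entKernel (tau a * tau b) ∂y ∂x := by
    rw [entropy_eq_integral_entKernel (chkOp_mem hx hy), integral_chkOp x y isBddMeas_entKernel]
    simp only [tau_tauInv (abs_tau_mul_tau_le_one _ _)]
  have b3 : IsBddMeas fun p : EReal × EReal => entKernel (tau p.1 * tau p.2) := by
    have := isBddMeas_entKernel.comp measurable_chk
    simpa only [tau_tauInv (abs_tau_mul_tau_le_one _ _)] using this
  have b1 : IsBddMeas fun p : EReal × EReal => entKernel (tau p.1) + entKernel (tau p.2) :=
    (isBddMeas_entKernel.comp measurable_fst).add (isBddMeas_entKernel.comp measurable_snd)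
  rw [h1, h2, ← integral_add ((b1.sub b3).integral_right y |>.integrable x)
    (b3.integral_right y |>.integrable x), entropy_eq_integral_entKernel hx,
    entropy_eq_integral_entKernel hy]
  have h3 : ∀ a, (∫ b, (entKernel (tau a) + entKernel (tau b) - entKernel (tau a * tau b)) ∂y)
      + ∫ b, entKernel (tau a * tau b) ∂y = entKernel (tau a) + ∫ b, entKernel (tau b) ∂y :=
    fun a => by
    rw [← integral_add (((b1.sub b3).comp (measurable_prodMk_left (x := a))).integrable y)
      ((b3.comp (measurable_prodMk_left (x := a))).integrable y)]
    simp only [sub_add_cancel]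
    rw [integral_add ((IsBddMeas.const _).integrable y) (isBddMeas_entKernel.integrable y)]
    simp
  simp only [h3]
  rw [integral_add (isBddMeas_entKernel.integrable x) ((IsBddMeas.const _).integrable x)]
  simp

/-- Duality together with multiplicativity under ⊠: (1 - m) + (1 - m') - (1 - mm') = (1 - m)(1 -
m'). Thus H(x ⊛ y) is explicit in the moments of x and y, although the moments of x ⊛ y themselves
are not. -/
theorem entropy_varOp {x y : Measure EReal} (hx : x ∈ symProb) (hy : y ∈ symProb) :
    entropy (varOp x y) =
      ∫ k : ℕ, (1 - tanhMoment (k + 1) x) * (1 - tanhMoment (k + 1) y) ∂gammaMeas := by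
  have := hx.1
  have := hy.1
  have bx := (IsBddMeas.const 1).sub (isBddMeas_tanhMoment hx)
  have bY := (IsBddMeas.const 1).sub (isBddMeas_tanhMoment hy)
  have bxy := (IsBddMeas.const 1).sub (isBddMeas_tanhMoment (chkOp_mem hx hy))
  rw [eq_sub_of_add_eq (entropy_varOp_add_entropy_chkOp hx hy), entropy_eq_integral hx,
    entropy_eq_integral hy, entropy_eq_integral (chkOp_mem hx hy),
    ← integral_add (bx.integrable _) (bY.integrable _),
    ← integral_sub ((bx.add bY).integrable _) (bxy.integrable _)]
  congr 1
  ext k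
  rw [tanhMoment_chkOp]
  ring

/-! ### Degradation is preserved by the density evolution operations -/

theorem isBddMeas_comp_abs_tau {f : ℝ → ℝ} (hf : AntitoneOn f (Set.Icc 0 1)) :
    IsBddMeas fun a => f |tau a| := by
  have hmem : ∀ a, |tau a| ∈ Set.Icc (0 : ℝ) 1 := fun a => ⟨abs_nonneg _, abs_tau_le_one a⟩
  constructor
  -- Nothing is known about `f` outside [0, 1]; clamping the argument gives a globally antitone,
  -- hence measurable, function.
  · have h : Antitone fun r : ℝ => f (max 0 (min r 1)) := fun r s hrs =>
      hf ⟨le_max_left _ _, max_le zero_le_one (min_le_right _ _)⟩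
        ⟨le_max_left _ _, max_le zero_le_one (min_le_right _ _)⟩
        (max_le_max le_rfl (min_le_min hrs le_rfl))
    have h2 : (fun a => f |tau a|) = (fun r : ℝ => f (max 0 (min r 1))) ∘ fun a => |tau a| := by
      ext a
      simp [min_eq_left (abs_tau_le_one a)]
    rw [h2]
    exact h.measurable.comp (by fun_prop)
  · refine ⟨max |f 1| |f 0|, fun a => ?_⟩
    exact abs_le_max_abs_abs (hf (hmem a) (by simp) (hmem a).2) (hf (by simp) (hmem a) (hmem a).1)

/-- The perspective of the even concave function `F(u) = f |u|`, precomposed with an affine map. -/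
def persp (f : ℝ → ℝ) (t s : ℝ) : ℝ := (1 + t * s) / 2 * f |(t + s) / (1 + t * s)|

theorem abs_add_le_one_add_mul {t s : ℝ} (ht : |t| ≤ 1) (hs : |s| ≤ 1) : |t + s| ≤ 1 + t * s := by
  have ht := abs_le.mp ht
  have hs := abs_le.mp hs
  exact abs_le.mpr ⟨by nlinarith, by nlinarith⟩

/-- For f concave and non-increasing, F(u) = f(|u|) is concave on [-1, 1], hence so is its
perspective (W, v) ↦ W F(v/W). Here W = 1 + ts and v = t + s are affine in s and satisfy |v| ≤ W. -/
theorem persp_concave {f : ℝ → ℝ} (hf : ConcaveOn ℝ (Set.Icc 0 1) f)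
    (hf' : AntitoneOn f (Set.Icc 0 1)) {t : ℝ} (ht : |t| ≤ 1) :
    ConcaveOn ℝ (Set.Icc (-1) 1) (persp f t) := by
  refine ⟨convex_Icc _ _, fun s₁ h₁ s₂ h₂ a b ha hb hab => ?_⟩
  simp only [smul_eq_mul]
  have w₁ := abs_add_le_one_add_mul ht (abs_le.mpr h₁)
  have w₂ := abs_add_le_one_add_mul ht (abs_le.mpr h₂)
  have hw : 1 + t * (a * s₁ + b * s₂) = a * (1 + t * s₁) + b * (1 + t * s₂) := by
    linear_combination -hab
  have hv : t + (a * s₁ + b * s₂) = a * (t + s₁) + b * (t + s₂) := by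
    linear_combination (-t) * hab
  unfold persp
  rw [hw, hv]
  set W₁ := 1 + t * s₁
  set W₂ := 1 + t * s₂
  set v₁ := t + s₁
  set v₂ := t + s₂
  have n₁ : 0 ≤ W₁ := (abs_nonneg _).trans w₁
  have n₂ : 0 ≤ W₂ := (abs_nonneg _).trans w₂
  -- If W₁ = 0 then |v₁| ≤ W₁ forces v₁ = 0, so division by zero does no harm.
  have q₁ : W₁ * (v₁ / W₁) = v₁ := by
    by_cases h : W₁ = 0
    · rw [h] at w₁ ⊢
      rw [abs_eq_zero.mp (le_antisymm w₁ (abs_nonneg _))]; simp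
    · field_simp
  have q₂ : W₂ * (v₂ / W₂) = v₂ := by
    by_cases h : W₂ = 0
    · rw [h] at w₂ ⊢
      rw [abs_eq_zero.mp (le_antisymm w₂ (abs_nonneg _))]; simp
    · field_simp
  have m₁ : |v₁ / W₁| ∈ Set.Icc (0 : ℝ) 1 :=
    ⟨abs_nonneg _, by rw [abs_div, abs_of_nonneg n₁]; exact div_le_one_of_le₀ w₁ n₁⟩
  have m₂ : |v₂ / W₂| ∈ Set.Icc (0 : ℝ) 1 :=
    ⟨abs_nonneg _, by rw [abs_div, abs_of_nonneg n₂]; exact div_le_one_of_le₀ w₂ n₂⟩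
  have p₁ := mul_nonneg ha n₁
  have p₂ := mul_nonneg hb n₂
  rcases (add_nonneg p₁ p₂).eq_or_lt with h0 | hpos
  · have z₁ : a * W₁ = 0 := by linarith
    have z₂ : b * W₂ = 0 := by linarith
    have e₁ : a * (W₁ / 2 * f |v₁ / W₁|) = 0 := by linear_combination f |v₁ / W₁| / 2 * z₁
    have e₂ : b * (W₂ / 2 * f |v₂ / W₂|) = 0 := by linear_combination f |v₂ / W₂| / 2 * z₂
    rw [← h0, e₁, e₂]
    simp
  · set W := a * W₁ + b * W₂
    have hc := hf.2 m₁ m₂ (div_nonneg p₁ hpos.le) (div_nonneg p₂ hpos.le)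
      (by rw [← add_div, div_self hpos.ne'])
    simp only [smul_eq_mul] at hc
    have hle : |(a * v₁ + b * v₂) / W| ≤ a * W₁ / W * |v₁ / W₁| + b * W₂ / W * |v₂ / W₂| := by
      have : (a * v₁ + b * v₂) / W = a * W₁ / W * (v₁ / W₁) + b * W₂ / W * (v₂ / W₂) := by
        rw [← q₁, ← q₂]
        field_simp
      rw [this]
      refine (abs_add_le _ _).trans_eq ?_
      rw [abs_mul, abs_mul, abs_of_nonneg (div_nonneg p₁ hpos.le),
        abs_of_nonneg (div_nonneg p₂ hpos.le)]
    have hle1 : a * W₁ / W * |v₁ / W₁| + b * W₂ / W * |v₂ / W₂| ≤ 1 := by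
      calc _ ≤ a * W₁ / W * 1 + b * W₂ / W * 1 :=
            add_le_add (mul_le_mul_of_nonneg_left m₁.2 (div_nonneg p₁ hpos.le))
              (mul_le_mul_of_nonneg_left m₂.2 (div_nonneg p₂ hpos.le))
        _ = 1 := by rw [mul_one, mul_one, ← add_div, div_self hpos.ne']
    have hm := hf' ⟨abs_nonneg _, hle.trans hle1⟩ ⟨(abs_nonneg _).trans hle, hle1⟩ hle
    have h3 := mul_le_mul_of_nonneg_left (hc.trans hm) (div_nonneg hpos.le zero_le_two)
    refine le_trans (le_of_eq ?_) h3
    field_simp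

/-- The kernel of the variable-node operation on even functions. -/
def varKernel (f : ℝ → ℝ) (t s : ℝ) : ℝ := persp f t s + persp f t (-s)

theorem varKernel_neg (f : ℝ → ℝ) (t s : ℝ) : varKernel f t (-s) = varKernel f t s := by
  unfold varKernel; rw [neg_neg, add_comm]

theorem varKernel_abs (f : ℝ → ℝ) (t s : ℝ) : varKernel f t |s| = varKernel f t s := by
  rcases abs_choice s with h | h <;> rw [h]
  exact varKernel_neg f t s

theorem varKernel_concave {f : ℝ → ℝ} (hf : ConcaveOn ℝ (Set.Icc 0 1) f)
    (hf' : AntitoneOn f (Set.Icc 0 1)) {t : ℝ} (ht : |t| ≤ 1) :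
    ConcaveOn ℝ (Set.Icc (-1) 1) (varKernel f t) := by
  have h := persp_concave hf hf' ht
  refine h.add ⟨convex_Icc _ _, fun s₁ h₁ s₂ h₂ a b ha hb hab => ?_⟩
  have := h.2 (x := -s₁) (y := -s₂) ⟨by linarith [h₁.2], by linarith [h₁.1]⟩
    ⟨by linarith [h₂.2], by linarith [h₂.1]⟩ ha hb hab
  rw [smul_neg, smul_neg, ← neg_add] at this
  exact this

/-- A point r in [0, s] is the convex combination of ±s with weights (1 ± r/s)/2, and `g` takes the
same value at both ends. -/
theorem antitoneOn_of_concaveOn_of_even {g : ℝ → ℝ} (hg : ConcaveOn ℝ (Set.Icc (-1) 1) g)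
    (heven : ∀ s, g (-s) = g s) : AntitoneOn g (Set.Icc 0 1) := by
  intro r hr s hs hrs
  rcases hs.1.eq_or_lt with h0 | hpos
  · rw [le_antisymm hrs (h0 ▸ hr.1)]
  have h1 : r / s ≤ 1 := div_le_one_of_le₀ hrs hpos.le
  have h0 : 0 ≤ r / s := div_nonneg hr.1 hpos.le
  have hs₁ : s ∈ Set.Icc (-1 : ℝ) 1 := ⟨by linarith, hs.2⟩
  have hs₂ : -s ∈ Set.Icc (-1 : ℝ) 1 := ⟨by linarith [hs.2], by linarith⟩
  have := hg.2 hs₁ hs₂ (show 0 ≤ (1 + r / s) / 2 by linarith)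
    (show 0 ≤ (1 - r / s) / 2 by linarith) (by ring)
  simp only [smul_eq_mul, heven] at this
  have e : (1 + r / s) / 2 * s + (1 - r / s) / 2 * -s = r := by field_simp; ring
  rw [e] at this
  linarith

theorem Degraded.refl (x : Measure EReal) : Degraded x x := fun _ _ _ => le_rfl

theorem Degraded.trans {x y z : Measure EReal} (h : Degraded x y) (h' : Degraded y z) :
    Degraded x z := fun f hf hf' => (h' f hf hf').trans (h f hf hf')

theorem degraded_deltaZero {x : Measure EReal} (hx : x ∈ symProb) : Degraded deltaZero x := by
  intro f _ hf'
  have := hx.1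
  have hb := isBddMeas_comp_abs_tau hf'
  rw [deltaZero, integral_dirac]
  calc ∫ a, f |tau a| ∂x ≤ ∫ _, f |tau 0| ∂x := by
        refine integral_mono (hb.integrable x) ((IsBddMeas.const _).integrable x) fun a => ?_
        refine hf' (by simp) ⟨abs_nonneg _, abs_tau_le_one a⟩ (by simp)
    _ = f |tau 0| := by simp

theorem degraded_deltaInf {x : Measure EReal} (hx : x ∈ symProb) : Degraded x deltaInf := by
  intro f _ hf'
  have := hx.1
  have hb := isBddMeas_comp_abs_tau hf'
  rw [deltaInf, integral_dirac]
  calc f |tau ⊤| = ∫ _, f |tau ⊤| ∂x := by simp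
    _ ≤ ∫ a, f |tau a| ∂x := by
        refine integral_mono ((IsBddMeas.const _).integrable x) (hb.integrable x) fun a => ?_
        refine hf' ⟨abs_nonneg _, abs_tau_le_one a⟩ (by simp) (by simpa using abs_tau_le_one a)

/-- With the variable from `b` fixed, the symmetrized test function is again concave and
non-increasing in |τ| of the other variable, so the hypothesis applies to it. -/
theorem Degraded.varOp_left {b x y : Measure EReal} (hb : b ∈ symProb) (hx : x ∈ symProb)
    (hy : y ∈ symProb) (h : Degraded x y) : Degraded (varOp b x) (varOp b y) := by
  intro f hf hf'
  have := hb.1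
  have := hx.1
  have := hy.1
  have hF := isBddMeas_comp_abs_tau hf'
  have hG : IsBddMeas fun p : EReal × EReal => f |tau (p.1 + p.2)| := hF.comp measurable_add
  have hG' : IsBddMeas fun p : EReal × EReal => f |tau (p.1 + -p.2)| :=
    hF.comp (g := fun p : EReal × EReal => p.1 + -p.2) (by fun_prop)
  have htt : IsBddMeas fun p : EReal × EReal => tau p.1 * tau p.2 :=
    (isBddMeas_tau.comp measurable_fst).mul (isBddMeas_tau.comp measurable_snd)
  have hJ : IsBddMeas fun p : EReal × EReal => (1 + tau p.1 * tau p.2) / 2 * f |tau (p.1 + p.2)|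
      + (1 - tau p.1 * tau p.2) / 2 * f |tau (p.1 + -p.2)| := by
    simp only [div_eq_mul_inv]
    exact ((((IsBddMeas.const 1).add htt).mul (IsBddMeas.const _)).mul hG).add
      ((((IsBddMeas.const 1).sub htt).mul (IsBddMeas.const _)).mul hG')
  have hK : ∀ a c, (1 + tau a * tau c) / 2 * f |tau (a + c)|
      + (1 - tau a * tau c) / 2 * f |tau (a + -c)| = varKernel f (tau a) |tau c| := fun a c => by
    rw [one_add_mul_abs_tau_add, one_sub_mul_abs_tau_add_neg, varKernel_abs, varKernel, persp,
      persp, mul_neg, ← sub_eq_add_neg, ← sub_eq_add_neg]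
  rw [integral_varOp b x hF, integral_varOp b y hF,
    integral_integral_symmetrize hb hx hG fun a c => by simp only [abs_tau_neg_add_neg],
    integral_integral_symmetrize hb hy hG fun a c => by simp only [abs_tau_neg_add_neg]]
  refine integral_mono ((hJ.integral_right y).integrable b) ((hJ.integral_right x).integrable b)
    fun a => ?_
  simp only [hK]
  have hc := varKernel_concave hf hf' (abs_tau_le_one a)
  exact h _ (hc.subset (Set.Icc_subset_Icc_left (by norm_num)) (convex_Icc _ _))
    (antitoneOn_of_concaveOn_of_even hc (varKernel_neg f _))

/-- With the variable `a` from `b` fixed, r ↦ f(|τ(a)| r) is an admissible test function. -/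
theorem Degraded.chkOp_left {b x y : Measure EReal} (hb : b ∈ symProb) (hx : x ∈ symProb)
    (hy : y ∈ symProb) (h : Degraded x y) : Degraded (chkOp b x) (chkOp b y) := by
  intro f hf hf'
  have := hb.1
  have := hx.1
  have := hy.1
  have hF := isBddMeas_comp_abs_tau hf'
  have hG := hF.comp measurable_chk
  rw [integral_chkOp b x hF, integral_chkOp b y hF]
  refine integral_mono ((hG.integral_right y).integrable b) ((hG.integral_right x).integrable b)
    fun a => ?_
  simp only [tau_tauInv (abs_tau_mul_tau_le_one _ _), abs_mul]
  have hm : ∀ {r : ℝ}, r ∈ Set.Icc (0 : ℝ) 1 → |tau a| * r ∈ Set.Icc (0 : ℝ) 1 := fun hr =>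
    ⟨mul_nonneg (abs_nonneg _) hr.1, mul_le_one₀ (abs_tau_le_one a) hr.1 hr.2⟩
  refine h (fun r => f (|tau a| * r)) ⟨convex_Icc _ _, fun r hr s hs p q hp hq hpq => ?_⟩
    fun r hr s hs hrs => hf' (hm hr) (hm hs) (mul_le_mul_of_nonneg_left hrs (abs_nonneg _))
  have := hf.2 (hm hr) (hm hs) hp hq hpq
  simp only [smul_eq_mul] at this ⊢
  convert this using 2
  ring

/-! ### Algebra of the two operations and degradation in both arguments -/

theorem varOp_comm {x y : Measure EReal} (hx : x ∈ symProb) (hy : y ∈ symProb) :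
    varOp x y = varOp y x := by
  have := hx.1
  have := hy.1
  exact Measure.conv_comm x y

theorem varOp_assoc {x y z : Measure EReal} (hx : x ∈ symProb) (hy : y ∈ symProb)
    (hz : z ∈ symProb) : varOp (varOp x y) z = varOp x (varOp y z) := by
  have := hx.1
  have := hy.1
  have := hz.1
  exact Measure.conv_assoc x y z

theorem chkOp_comm {x y : Measure EReal} (hx : x ∈ symProb) (hy : y ∈ symProb) :
    chkOp x y = chkOp y x := by
  have := hx.1
  have := hy.1
  rw [chkOp, ← Measure.prod_swap, Measure.map_map measurable_chk measurable_swap, chkOp]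
  congr 1
  ext p
  simp [mul_comm]

theorem Degraded.varOp {x₁ x₂ y₁ y₂ : Measure EReal} (hx₁ : x₁ ∈ symProb) (hx₂ : x₂ ∈ symProb)
    (hy₁ : y₁ ∈ symProb) (hy₂ : y₂ ∈ symProb) (hx : Degraded x₁ x₂) (hy : Degraded y₁ y₂) :
    Degraded (varOp x₁ y₁) (varOp x₂ y₂) := by
  refine (hy.varOp_left hx₁ hy₁ hy₂).trans ?_
  rw [varOp_comm hx₁ hy₂, varOp_comm hx₂ hy₂]
  exact hx.varOp_left hy₂ hx₁ hx₂

theorem Degraded.chkOp {x₁ x₂ y₁ y₂ : Measure EReal} (hx₁ : x₁ ∈ symProb) (hx₂ : x₂ ∈ symProb)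
    (hy₁ : y₁ ∈ symProb) (hy₂ : y₂ ∈ symProb) (hx : Degraded x₁ x₂) (hy : Degraded y₁ y₂) :
    Degraded (chkOp x₁ y₁) (chkOp x₂ y₂) := by
  refine (hy.chkOp_left hx₁ hy₁ hy₂).trans ?_
  rw [chkOp_comm hx₁ hy₂, chkOp_comm hx₂ hy₂]
  exact hx.chkOp_left hy₂ hx₁ hx₂

theorem degraded_sum_smul {ι : Type*} {s : Finset ι} {p : ι → ℝ≥0} {μ ν : ι → Measure EReal}
    (hμ : ∀ i ∈ s, μ i ∈ symProb) (hν : ∀ i ∈ s, ν i ∈ symProb)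
    (h : ∀ i ∈ s, Degraded (μ i) (ν i)) :
    Degraded (∑ i ∈ s, p i • μ i) (∑ i ∈ s, p i • ν i) := by
  intro f hf hf'
  rw [integral_sum_smul hμ (isBddMeas_comp_abs_tau hf'),
    integral_sum_smul hν (isBddMeas_comp_abs_tau hf')]
  exact Finset.sum_le_sum fun i hi => mul_le_mul_of_nonneg_left (h i hi f hf hf') (p i).2

theorem Degraded.varPow {x y : Measure EReal} (hx : x ∈ symProb) (hy : y ∈ symProb)
    (h : Degraded x y) (n : ℕ) :
    Degraded (opPow SCLDPC.varOp deltaZero x n) (opPow SCLDPC.varOp deltaZero y n) := by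
  induction n with
  | zero => exact .refl _
  | succ n ih => exact ih.varOp (varPow_mem hx n) (varPow_mem hy n) hx hy h

theorem Degraded.chkPow {x y : Measure EReal} (hx : x ∈ symProb) (hy : y ∈ symProb)
    (h : Degraded x y) (n : ℕ) :
    Degraded (opPow SCLDPC.chkOp deltaInf x n) (opPow SCLDPC.chkOp deltaInf y n) := by
  induction n with
  | zero => exact .refl _
  | succ n ih => exact ih.chkOp (chkPow_mem hx n) (chkPow_mem hy n) hx hy h

theorem Degraded.varPoly {x y : Measure EReal} (hx : x ∈ symProb) (hy : y ∈ symProb)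
    (h : Degraded x y) (p : ℝ≥0[X]) : Degraded (varPoly p x) (varPoly p y) :=
  degraded_sum_smul (fun n _ => varPow_mem hx n) (fun n _ => varPow_mem hy n)
    fun n _ => h.varPow hx hy n

theorem Degraded.chkPoly {x y : Measure EReal} (hx : x ∈ symProb) (hy : y ∈ symProb)
    (h : Degraded x y) (p : ℝ≥0[X]) : Degraded (chkPoly p x) (chkPoly p y) :=
  degraded_sum_smul (fun n _ => chkPow_mem hx n) (fun n _ => chkPow_mem hy n)
    fun n _ => h.chkPow hx hy n

theorem degraded_average (w : ℕ) {f g : ℕ → Measure EReal} (hf : ∀ k, f k ∈ symProb)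
    (hg : ∀ k, g k ∈ symProb) (h : ∀ k, Degraded (f k) (g k)) :
    Degraded (average w f) (average w g) := by
  rw [average_eq, average_eq]
  exact degraded_sum_smul (fun k _ => hf k) (fun k _ => hg k) fun k _ => h k

theorem Degraded.tanhMoment_le {x y : Measure EReal} (h : Degraded x y) (k : ℕ) :
    tanhMoment k x ≤ tanhMoment k y := by
  have hconv : ConvexOn ℝ (Set.Icc (0 : ℝ) 1) fun r => r ^ (2 * k) :=
    (convexOn_pow (2 * k)).subset (fun r hr => hr.1) (convex_Icc _ _)
  have := h (fun r => -r ^ (2 * k)) hconv.neg fun r hr s _ hrs =>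
    neg_le_neg (pow_le_pow_left₀ hr.1 hrs _)
  simp only [(even_two_mul k).pow_abs, integral_neg] at this
  exact neg_le_neg_iff.mp this

theorem Degraded.entropy_le {x y : Measure EReal} (hx : x ∈ symProb) (hy : y ∈ symProb)
    (h : Degraded x y) : entropy y ≤ entropy x :=
  entropy_mono hy hx h.tanhMoment_le

/-! ### Linearity of the variable-node operation -/

theorem integral_varOp_sum_smul {ι : Type*} {s : Finset ι} {p : ι → ℝ≥0} {μ : ι → Measure EReal}
    (hp : ∑ i ∈ s, p i = 1) (hμ : ∀ i ∈ s, μ i ∈ symProb) {q : Measure EReal} (hq : q ∈ symProb)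
    {φ : EReal → ℝ} (hφ : IsBddMeas φ) :
    ∫ a, φ a ∂varOp q (∑ i ∈ s, p i • μ i) = ∑ i ∈ s, (p i : ℝ) * ∫ a, φ a ∂varOp q (μ i) := by
  have hs := sum_smul_mem hp hμ
  have := hq.1
  have := hs.1
  rw [varOp_comm hq hs, integral_varOp _ _ hφ,
    integral_sum_smul hμ ((hφ.comp measurable_add).integral_right q)]
  refine Finset.sum_congr rfl fun i hi => ?_
  have := (hμ i hi).1
  rw [varOp_comm hq (hμ i hi), integral_varOp _ _ hφ]

theorem integral_varOp_varPoly {p : ℝ≥0[X]} (hp : p.eval 1 = 1) {q z : Measure EReal}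
    (hq : q ∈ symProb) (hz : z ∈ symProb) {φ : EReal → ℝ} (hφ : IsBddMeas φ) :
    ∫ a, φ a ∂varOp q (varPoly p z) =
      ∑ n ∈ p.support, (p.coeff n : ℝ) * ∫ a, φ a ∂varOp q (opPow varOp deltaZero z n) :=
  integral_varOp_sum_smul ((sum_coeff_eq_eval_one p).trans hp) (fun n _ => varPow_mem hz n) hq hφ

theorem integral_varOp_chkPoly {p : ℝ≥0[X]} (hp : p.eval 1 = 1) {q z : Measure EReal}
    (hq : q ∈ symProb) (hz : z ∈ symProb) {φ : EReal → ℝ} (hφ : IsBddMeas φ) :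
    ∫ a, φ a ∂varOp q (chkPoly p z) =
      ∑ n ∈ p.support, (p.coeff n : ℝ) * ∫ a, φ a ∂varOp q (opPow chkOp deltaInf z n) :=
  integral_varOp_sum_smul ((sum_coeff_eq_eval_one p).trans hp) (fun n _ => chkPow_mem hz n) hq hφ

theorem sum_range_inv_eq_one {w : ℕ} (hw : 0 < w) :
    ∑ _k ∈ Finset.range w, (w : ℝ≥0)⁻¹ = 1 := by
  rw [Finset.sum_const, Finset.card_range, nsmul_eq_mul, mul_inv_cancel₀]
  exact_mod_cast hw.ne'

theorem integral_varOp_average {w : ℕ} (hw : 0 < w) {f : ℕ → Measure EReal}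
    (hf : ∀ k, f k ∈ symProb) {q : Measure EReal} (hq : q ∈ symProb) {φ : EReal → ℝ}
    (hφ : IsBddMeas φ) : ∫ a, φ a ∂varOp q (average w f) =
      (w : ℝ)⁻¹ * ∑ k ∈ Finset.range w, ∫ a, φ a ∂varOp q (f k) := by
  rw [average_eq, integral_varOp_sum_smul (sum_range_inv_eq_one hw) (fun k _ => hf k) hq hφ,
    Finset.mul_sum]
  simp

theorem average_const {w : ℕ} (hw : 0 < w) (μ : Measure EReal) : average w (fun _ => μ) = μ := by
  rw [average_eq, ← Finset.sum_smul, sum_range_inv_eq_one hw, one_smul]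

theorem entropy_varOp_varPoly {p : ℝ≥0[X]} (hp : p.eval 1 = 1) {q z : Measure EReal}
    (hq : q ∈ symProb) (hz : z ∈ symProb) : entropy (varOp q (varPoly p z)) =
      ∑ n ∈ p.support, (p.coeff n : ℝ) * entropy (varOp q (opPow varOp deltaZero z n)) := by
  rw [entropy_eq_integral_entKernel (varOp_mem hq (varPoly_mem hp hz)),
    integral_varOp_varPoly hp hq hz isBddMeas_entKernel]
  refine Finset.sum_congr rfl fun n _ => ?_
  rw [entropy_eq_integral_entKernel (varOp_mem hq (varPow_mem hz n))]

theorem varOp_deltaZero {x : Measure EReal} (hx : x ∈ symProb) : varOp x deltaZero = x := by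
  have := hx.1
  exact Measure.conv_dirac_zero x

theorem deltaInf_varOp {x : Measure EReal} (hx : x ∈ symProb) : varOp deltaInf x = deltaInf := by
  have := hx.1
  rw [varOp, deltaInf, Measure.dirac_conv]
  have h : (fun y : EReal => ⊤ + y) =ᵐ[x] fun _ => ⊤ :=
    hx.2.ae_ne_bot.mono fun a ha => EReal.top_add_of_ne_bot ha
  rw [Measure.map_congr h, Measure.map_const]
  simp

/-! ### Second-order expansion of the variable-node part of the potential -/

/-- The measure `c ⊛ z^{⊛ a} ⊛ z'^{⊛ b}`. -/
def mixPow (c z z' : Measure EReal) (a b : ℕ) : Measure EReal :=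
  varOp (varOp c (opPow varOp deltaZero z a)) (opPow varOp deltaZero z' b)

theorem mixPow_mem {c z z' : Measure EReal} (hc : c ∈ symProb) (hz : z ∈ symProb)
    (hz' : z' ∈ symProb) (a b : ℕ) : mixPow c z z' a b ∈ symProb :=
  varOp_mem (varOp_mem hc (varPow_mem hz a)) (varPow_mem hz' b)

theorem mixPow_succ_right {c z z' : Measure EReal} (hc : c ∈ symProb) (hz : z ∈ symProb)
    (hz' : z' ∈ symProb) (a b : ℕ) :
    mixPow c z z' a (b + 1) = varOp (mixPow c z z' a b) z' :=
  (varOp_assoc (varOp_mem hc (varPow_mem hz a)) (varPow_mem hz' b) hz').symm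

theorem mixPow_succ_left {c z z' : Measure EReal} (hc : c ∈ symProb) (hz : z ∈ symProb)
    (hz' : z' ∈ symProb) (a b : ℕ) :
    mixPow c z z' (a + 1) b = varOp (mixPow c z z' a b) z := by
  have ha := varPow_mem hz a
  have hb := varPow_mem hz' b
  have h1 := varOp_mem hc ha
  rw [mixPow, opPow, ← varOp_assoc hc ha hz, varOp_assoc h1 hz hb, varOp_comm hz hb,
    ← varOp_assoc h1 hb hz, mixPow]

theorem mixPow_zero_left {c z z' : Measure EReal} (hc : c ∈ symProb) (b : ℕ) :
    mixPow c z z' 0 b = varOp c (opPow varOp deltaZero z' b) := by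
  rw [mixPow, opPow, varOp_deltaZero hc]

theorem mixPow_zero_right {c z z' : Measure EReal} (hc : c ∈ symProb) (hz : z ∈ symProb) (a : ℕ) :
    mixPow c z z' a 0 = varOp c (opPow varOp deltaZero z a) := by
  rw [mixPow]
  exact varOp_deltaZero (varOp_mem hc (varPow_mem hz a))

/-- The second difference of the entropy of a variable-node convolution. -/
theorem entropy_second_difference {q z z' : Measure EReal} (hq : q ∈ symProb) (hz : z ∈ symProb)
    (hz' : z' ∈ symProb) : entropy (varOp (varOp q z') z') - 2 * entropy (varOp (varOp q z) z')
      + entropy (varOp (varOp q z) z) = ∫ k : ℕ,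
        (tanhMoment (k + 1) (varOp q z') - tanhMoment (k + 1) (varOp q z)) *
          (tanhMoment (k + 1) z' - tanhMoment (k + 1) z) ∂gammaMeas := by
  have hqz := varOp_mem hq hz
  have hqz' := varOp_mem hq hz'
  have hcomm : varOp (varOp q z) z' = varOp (varOp q z') z := by
    rw [varOp_assoc hq hz hz', varOp_comm hz hz', varOp_assoc hq hz' hz]
  have b1 := (IsBddMeas.const 1).sub (isBddMeas_tanhMoment hz)
  have b2 := (IsBddMeas.const 1).sub (isBddMeas_tanhMoment hz')
  have b3 := (IsBddMeas.const 1).sub (isBddMeas_tanhMoment hqz)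
  have b4 := (IsBddMeas.const 1).sub (isBddMeas_tanhMoment hqz')
  -- The two copies of the middle term are ordered differently, which exhibits a difference of
  -- differences to which the product formula applies.
  have e : entropy (varOp (varOp q z') z') - 2 * entropy (varOp (varOp q z) z')
      + entropy (varOp (varOp q z) z) = (entropy (varOp (varOp q z') z')
      - entropy (varOp (varOp q z) z')) - (entropy (varOp (varOp q z') z)
      - entropy (varOp (varOp q z) z)) := by rw [hcomm]; ring
  rw [e, entropy_varOp hqz' hz', entropy_varOp hqz hz', entropy_varOp hqz' hz,
    entropy_varOp hqz hz, ← integral_sub ((b4.mul b2).integrable _) ((b3.mul b2).integrable _),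
    ← integral_sub ((b4.mul b1).integrable _) ((b3.mul b1).integrable _),
    ← integral_sub (((b4.mul b2).sub (b3.mul b2)).integrable _)
      (((b4.mul b1).sub (b3.mul b1)).integrable _)]
  congr 1
  ext k
  ring

/-- Taylor bound for an array with bounded mixed second differences. -/
theorem taylor_of_second_difference {F : ℕ → ℕ → ℝ} {D : ℝ}
    (h : ∀ a b, F a (b + 2) - 2 * F (a + 1) (b + 1) + F (a + 2) b ≤ D) (n : ℕ) :
    F 0 n - F n 0 ≤ n * (F (n - 1) 1 - F (n - 1 + 1) 0 + ((n - 1 : ℕ) : ℝ) / 2 * D) := by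
  -- Along an antidiagonal, consecutive exchanges of one copy differ by at most D; everything is
  -- compared with the last exchange.
  have h1 : ∀ b a, F a (b + 1) - F (a + 1) b ≤ F (a + b) 1 - F (a + b + 1) 0 + b * D := by
    intro b
    induction b with
    | zero => intro a; simp
    | succ b ih =>
      intro a
      have h1 := ih (a + 1)
      have h2 := h a b
      rw [show a + 1 + b = a + (b + 1) by ring] at h1
      push_cast
      linarith
  -- Adding the b + 1 exchanges gives the error D(0 + 1 + ... + b) = (b + 1) · b/2 · D.
  have h2 : ∀ b a, F a (b + 1) - F (a + b + 1) 0 ≤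
      (b + 1) * (F (a + b) 1 - F (a + b + 1) 0 + b / 2 * D) := by
    intro b
    induction b with
    | zero => intro a; simp
    | succ b ih =>
      intro a
      have i1 := ih (a + 1)
      have i2 := h1 (b + 1) a
      rw [show a + 1 + b = a + (b + 1) by ring] at i1
      push_cast at i1 i2 ⊢
      linarith
  cases n with
  | zero => simp
  | succ n =>
    have := h2 n 0
    rw [zero_add] at this
    push_cast
    exact this

/-! ### From node-perspective to edge-perspective sums -/

theorem nodePersp_eval_one {p : ℝ≥0[X]} (hp : p.eval 1 = 1) : (nodePersp p).eval 1 = 1 :=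
  (nodePersp_spec hp).2.1

theorem nodePersp_coeff_succ {p : ℝ≥0[X]} (hp : p.eval 1 = 1) (n : ℕ) :
    ((nodePersp p).coeff (n + 1) : ℝ) * ((n : ℝ) + 1) =
      ((nodePersp p).derivative.eval 1 : ℝ≥0) * (p.coeff n : ℝ) := by
  have h := congrArg (fun q => Polynomial.coeff q n) (nodePersp_spec hp).2.2.2
  simp only [Polynomial.coeff_derivative, Polynomial.coeff_C_mul] at h
  exact_mod_cast h

theorem sum_support_eq_sum_range {p : ℝ≥0[X]} {N : ℕ} (hN : p.natDegree < N) (g : ℕ → ℝ) :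
    ∑ n ∈ p.support, (p.coeff n : ℝ) * g n = ∑ n ∈ Finset.range N, (p.coeff n : ℝ) * g n := by
  refine Finset.sum_subset (fun n hn => ?_) fun n _ hn => ?_
  · exact Finset.mem_range.mpr ((Polynomial.le_natDegree_of_mem_supp n hn).trans_lt hN)
  · rw [Polynomial.notMem_support_iff.mp hn]; simp

/-- This is P' = P'(1) p read coefficientwise. The truncated n - 1 at n = 0 is harmless because of
the factor n. -/
theorem sum_nodePersp {p : ℝ≥0[X]} (hp : p.eval 1 = 1) (g : ℕ → ℝ) :
    ∑ n ∈ (nodePersp p).support, ((nodePersp p).coeff n : ℝ) * (n * g (n - 1)) =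
      ((nodePersp p).derivative.eval 1 : ℝ≥0) * ∑ n ∈ p.support, (p.coeff n : ℝ) * g n := by
  set N := max p.natDegree (nodePersp p).natDegree + 1
  rw [sum_support_eq_sum_range (N := N + 1) (by omega), sum_support_eq_sum_range (N := N) (by omega),
    Finset.sum_range_succ', Finset.mul_sum]
  simp only [Nat.cast_zero, zero_mul, mul_zero, add_zero]
  refine Finset.sum_congr rfl fun n _ => ?_
  rw [← mul_assoc, ← mul_assoc, ← nodePersp_coeff_succ hp]
  simp

theorem sum_coeff_mul_natCast (p : ℝ≥0[X]) :
    ∑ n ∈ p.support, (p.coeff n : ℝ) * (n : ℝ) = (p.derivative.eval 1 : ℝ≥0) := by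
  rw [Polynomial.derivative_eval, Polynomial.sum]
  push_cast
  simp

namespace Ensemble

variable (E : Ensemble)

theorem L_one : E.L.eval 1 = 1 := nodePersp_eval_one E.lam_one

theorem R_one : E.R.eval 1 = 1 := nodePersp_eval_one E.rho_one

/-- Expand each power of L around `z`. A mixed second difference is an integral of two moment
increments; only one of them is bounded by κ, the other is kept as an entropy difference so that it
telescopes when summed along the chain. -/
theorem entropy_var_taylor {c z z' : Measure EReal} (hc : c ∈ symProb) (hz : z ∈ symProb)
    (hz' : z' ∈ symProb) (hle : ∀ k, tanhMoment k z ≤ tanhMoment k z') {κ : ℝ}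
    (hκ : ∀ q ∈ symProb, ∀ k, tanhMoment k (varOp q z') - tanhMoment k (varOp q z) ≤ κ) :
    entropy (varOp c (varPoly E.L z')) - entropy (varOp c (varPoly E.L z)) ≤
      E.dL * (entropy (varOp (varOp c (varPoly E.lam z)) z')
        - entropy (varOp (varOp c (varPoly E.lam z)) z))
      + E.dL * (E.lam.derivative.eval 1 : ℝ≥0) / 2 * (κ * (entropy z - entropy z')) := by
  have hP := fun a b => mixPow_mem hc hz hz' a b
  have bz := isBddMeas_tanhMoment hz
  have bz' := isBddMeas_tanhMoment hz'
  set F : ℕ → ℕ → ℝ := fun a b => entropy (mixPow c z z' a b) with hF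
  have hF2 : ∀ a b, F a (b + 2) - 2 * F (a + 1) (b + 1) + F (a + 2) b ≤
      κ * (entropy z - entropy z') := by
    intro a b
    have b1 := isBddMeas_tanhMoment (varOp_mem (hP a b) hz)
    have b2 := isBddMeas_tanhMoment (varOp_mem (hP a b) hz')
    simp only [hF]
    rw [mixPow_succ_right hc hz hz' a (b + 1), mixPow_succ_right hc hz hz' a b,
      mixPow_succ_right hc hz hz' (a + 1) b, mixPow_succ_left hc hz hz' (a + 1) b,
      mixPow_succ_left hc hz hz' a b, entropy_second_difference (hP a b) hz hz',
      entropy_eq_integral hz, entropy_eq_integral hz',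
      ← integral_sub (((IsBddMeas.const 1).sub bz).integrable _)
        (((IsBddMeas.const 1).sub bz').integrable _), ← integral_const_mul]
    refine integral_mono (((b2.sub b1).mul (bz'.sub bz)).integrable _)
      (((IsBddMeas.const κ).mul (((IsBddMeas.const 1).sub bz).sub
        ((IsBddMeas.const 1).sub bz'))).integrable _) fun k => ?_
    simp only [sub_sub_sub_cancel_left]
    exact mul_le_mul_of_nonneg_right (hκ _ (hP a b) _) (sub_nonneg.mpr (hle _))
  have hT := taylor_of_second_difference hF2
  have hL : ∀ {y}, y ∈ symProb → entropy (varOp c (varPoly E.L y)) = ∑ n ∈ E.L.support,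
      (E.L.coeff n : ℝ) * entropy (varOp c (opPow varOp deltaZero y n)) := fun hy =>
    entropy_varOp_varPoly E.L_one hc hy
  have hlam : ∀ {y}, y ∈ symProb → entropy (varOp (varOp c (varPoly E.lam z)) y) =
      ∑ n ∈ E.lam.support, (E.lam.coeff n : ℝ) *
        entropy (varOp (varOp c (opPow varOp deltaZero z n)) y) := fun {y} hy => by
    have hl := varPoly_mem E.lam_one hz
    rw [varOp_assoc hc hl hy, varOp_comm hl hy, ← varOp_assoc hc hy hl,
      entropy_varOp_varPoly E.lam_one (varOp_mem hc hy) hz]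
    refine Finset.sum_congr rfl fun n _ => ?_
    have hn := varPow_mem hz n
    rw [varOp_assoc hc hn hy, varOp_comm hn hy, ← varOp_assoc hc hy hn]
  have hF1 : ∀ n, F n 1 = entropy (varOp (varOp c (opPow varOp deltaZero z n)) z') := fun n => by
    simp only [hF]
    rw [show (1 : ℕ) = 0 + 1 from rfl, mixPow_succ_right hc hz hz', mixPow_zero_right hc hz]
  have hF0 : ∀ n, F (n + 1) 0 = entropy (varOp (varOp c (opPow varOp deltaZero z n)) z) :=
    fun n => by
    simp only [hF]
    rw [mixPow_succ_left hc hz hz', mixPow_zero_right hc hz]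
  calc entropy (varOp c (varPoly E.L z')) - entropy (varOp c (varPoly E.L z))
      = ∑ n ∈ E.L.support, (E.L.coeff n : ℝ) * (F 0 n - F n 0) := by
        rw [hL hz', hL hz, ← Finset.sum_sub_distrib]
        refine Finset.sum_congr rfl fun n _ => ?_
        rw [← mul_sub]
        simp only [hF]
        rw [mixPow_zero_left hc, mixPow_zero_right hc hz]
    _ ≤ ∑ n ∈ E.L.support, (E.L.coeff n : ℝ) * (n * (F (n - 1) 1 - F (n - 1 + 1) 0
          + ((n - 1 : ℕ) : ℝ) / 2 * (κ * (entropy z - entropy z')))) :=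
        Finset.sum_le_sum fun n _ => mul_le_mul_of_nonneg_left (hT n) (E.L.coeff n).2
    _ = E.dL * ∑ n ∈ E.lam.support, (E.lam.coeff n : ℝ) * (F n 1 - F (n + 1) 0
          + (n : ℝ) / 2 * (κ * (entropy z - entropy z'))) :=
        sum_nodePersp E.lam_one fun n => F n 1 - F (n + 1) 0
          + (n : ℝ) / 2 * (κ * (entropy z - entropy z'))
    _ = _ := by
        rw [hlam hz', hlam hz, ← sum_coeff_mul_natCast, ← Finset.sum_sub_distrib]
        simp only [hF1, hF0, Finset.mul_sum, Finset.sum_mul, Finset.sum_div,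
          ← Finset.sum_add_distrib]
        refine Finset.sum_congr rfl fun n _ => ?_
        ring

/-- The difference of two check-node outputs has total variation at most `ρ'(1)`. -/
theorem tanhMoment_varOp_chkPoly_sub_le {q x x' : Measure EReal} (hq : q ∈ symProb)
    (hx : x ∈ symProb) (hx' : x' ∈ symProb) (k : ℕ) :
    tanhMoment k (varOp q (chkPoly E.rho x')) - tanhMoment k (varOp q (chkPoly E.rho x)) ≤
      (E.rho.derivative.eval 1 : ℝ≥0) := by
  unfold tanhMoment
  rw [integral_varOp_chkPoly E.rho_one hq hx (isBddMeas_tau_pow _),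
    integral_varOp_chkPoly E.rho_one hq hx' (isBddMeas_tau_pow _), ← sum_coeff_mul_natCast,
    ← Finset.sum_sub_distrib]
  refine Finset.sum_le_sum fun n _ => ?_
  rw [← mul_sub]
  refine mul_le_mul_of_nonneg_left ?_ (E.rho.coeff n).2
  cases n with
  | zero => simp [opPow]
  | succ n =>
    have h1 := (varOp_mem hq (chkPow_mem hx' (n + 1))).1
    have h2 := tanhMoment_le_one k (varOp q (opPow chkOp deltaInf x' (n + 1)))
    have h3 := tanhMoment_nonneg k (varOp q (opPow chkOp deltaInf x (n + 1)))
    unfold tanhMoment at h2 h3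
    push_cast
    linarith [n.cast_nonneg (α := ℝ)]

/-- The degree-zero part Δ_∞ has no entropy, and for n ≥ 1 the entropy is at most 1 ≤ n. The trivial
bound 1 would not suffice: when ρ'(1) < 1 the final constant need not be covered by K. -/
theorem entropy_chkPoly_rho_le {x : Measure EReal} (hx : x ∈ symProb) :
    entropy (chkPoly E.rho x) ≤ (E.rho.derivative.eval 1 : ℝ≥0) := by
  have hy := chkPoly_mem E.rho_one hx
  rw [entropy_eq_integral_entKernel hy, integral_chkPoly _ hx isBddMeas_entKernel,
    ← sum_coeff_mul_natCast]
  refine Finset.sum_le_sum fun n _ => mul_le_mul_of_nonneg_left ?_ (E.rho.coeff n).2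
  rw [← entropy_eq_integral_entKernel (chkPow_mem hx n)]
  cases n with
  | zero =>
    rw [entropy_eq_integral (chkPow_mem hx 0)]
    simp [opPow]
  | succ n =>
    have := entropy_le_one (chkPow_mem hx (n + 1))
    push_cast
    linarith [n.cast_nonneg (α := ℝ)]

end Ensemble

/-! ### The check-node part of the potential -/

theorem evalReal_one {p : ℝ≥0[X]} (hp : p.eval 1 = 1) : evalReal p 1 = 1 := by
  have := (sum_coeff_eq_eval_one p).trans hp
  simp only [evalReal, one_pow, mul_one]
  exact_mod_cast this

theorem evalReal_nonneg (p : ℝ≥0[X]) {t : ℝ} (ht : 0 ≤ t) : 0 ≤ evalReal p t :=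
  Finset.sum_nonneg fun n _ => mul_nonneg (p.coeff n).2 (pow_nonneg ht n)

theorem evalReal_mono (p : ℝ≥0[X]) {s t : ℝ} (hs : 0 ≤ s) (hst : s ≤ t) :
    evalReal p s ≤ evalReal p t :=
  Finset.sum_le_sum fun n _ =>
    mul_le_mul_of_nonneg_left (pow_le_pow_left₀ hs hst n) (p.coeff n).2

theorem evalReal_le_one {p : ℝ≥0[X]} (hp : p.eval 1 = 1) {t : ℝ} (ht : 0 ≤ t) (ht' : t ≤ 1) :
    evalReal p t ≤ 1 := evalReal_one hp ▸ evalReal_mono p ht ht'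

/-- Convexity: the tangent line at `t` lies below the graph at `s`. -/
theorem pow_sub_pow_le {s t : ℝ} (hs : 0 ≤ s) (hst : s ≤ t) (n : ℕ) :
    t ^ n - s ^ n ≤ n * (t ^ (n - 1) * (t - s)) := by
  induction n with
  | zero => simp
  | succ n ih =>
    have h1 : t ^ (n + 1) - s ^ (n + 1) = t ^ n * (t - s) + s * (t ^ n - s ^ n) := by ring
    have ht := hs.trans hst
    have h2 : s * (t ^ n - s ^ n) ≤ t * (n * (t ^ (n - 1) * (t - s))) :=
      mul_le_mul hst ih (sub_nonneg.mpr (pow_le_pow_left₀ hs hst n)) ht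
    rw [h1, Nat.add_sub_cancel]
    push_cast
    refine (add_le_add_right h2 _).trans (le_of_eq ?_)
    cases n with
    | zero => simp
    | succ n => simp only [Nat.add_sub_cancel]; ring

theorem evalReal_nodePersp_sub_le {p : ℝ≥0[X]} (hp : p.eval 1 = 1) {s t : ℝ} (hs : 0 ≤ s)
    (hst : s ≤ t) : evalReal (nodePersp p) t - evalReal (nodePersp p) s ≤
      ((nodePersp p).derivative.eval 1 : ℝ≥0) * (evalReal p t * (t - s)) := by
  rw [evalReal, evalReal, ← Finset.sum_sub_distrib, evalReal, Finset.sum_mul]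
  calc _ ≤ ∑ n ∈ (nodePersp p).support, ((nodePersp p).coeff n : ℝ) *
        (n * (t ^ (n - 1) * (t - s))) := Finset.sum_le_sum fun n _ => by
        rw [← mul_sub]
        exact mul_le_mul_of_nonneg_left (pow_sub_pow_le hs hst n) ((nodePersp p).coeff n).2
    _ = _ := by
        rw [sum_nodePersp hp fun n => t ^ n * (t - s)]
        simp only [mul_assoc]

theorem isBddMeas_evalReal {p : ℝ≥0[X]} (hp : p.eval 1 = 1) {x : Measure EReal}
    (hx : x ∈ symProb) : IsBddMeas fun k : ℕ => evalReal p (tanhMoment (k + 1) x) := by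
  have := isBddMeas_tanhMoment (chkPoly_mem hp hx)
  simpa only [tanhMoment_chkPoly _ _ hx] using this

theorem IsBddMeas.sum {α ι : Type*} [MeasurableSpace α] {s : Finset ι} {φ : ι → α → ℝ}
    (h : ∀ i ∈ s, IsBddMeas (φ i)) : IsBddMeas fun a => ∑ i ∈ s, φ i a := by
  classical
  induction s using Finset.induction_on with
  | empty => simpa using IsBddMeas.const 0
  | insert i s hi ih =>
    simp only [Finset.sum_insert hi]
    exact (h i (by simp)).add (ih fun j hj => h j (by simp [hj]))

namespace Ensemble

variable (E : Ensemble)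

/-- The check-node part of the potential functional. -/
def checkPotential (x : Measure EReal) : ℝ :=
  (E.dL : ℝ) / E.dR * entropy (chkPoly E.R x) + E.dL * entropy (chkPoly E.rho x)
    - E.dL * entropy (chkOp x (chkPoly E.rho x))

theorem dR_ne_zero : (E.dR : ℝ) ≠ 0 := by
  exact_mod_cast (nodePersp_spec E.rho_one).2.2.1

theorem checkPotential_deltaInf : E.checkPotential deltaInf = 0 := by
  have h := deltaInf_mem
  rw [checkPotential, entropy_eq_integral (chkPoly_mem E.R_one h),
    entropy_eq_integral (chkPoly_mem E.rho_one h),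
    entropy_eq_integral (chkOp_mem h (chkPoly_mem E.rho_one h))]
  have := (chkPoly_mem E.rho_one h).1
  simp [tanhMoment_chkPoly _ _ h, tanhMoment_chkOp, evalReal_one E.R_one, evalReal_one E.rho_one]

/-- For moments m ≤ m', convexity gives R(m') - R(m) ≤ R'(1) ρ(m')(m' - m). Inserting this, the
other terms collapse to L'(1)(ρ(m') - ρ(m))(1 - m), so the check part leaves no second-order error.
-/
theorem checkPotential_sub_le {x x' : Measure EReal} (hx : x ∈ symProb) (hx' : x' ∈ symProb)
    (hle : ∀ k, tanhMoment k x ≤ tanhMoment k x') :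
    E.checkPotential x - E.checkPotential x' ≤ E.dL * ∫ k : ℕ,
      (evalReal E.rho (tanhMoment (k + 1) x') - evalReal E.rho (tanhMoment (k + 1) x)) *
        (1 - tanhMoment (k + 1) x) ∂gammaMeas := by
  have key : ∀ {y}, y ∈ symProb → IsBddMeas (fun k : ℕ =>
      (E.dL : ℝ) / E.dR * (1 - evalReal E.R (tanhMoment (k + 1) y))
        + E.dL * (1 - evalReal E.rho (tanhMoment (k + 1) y))
        - E.dL * (1 - tanhMoment (k + 1) y * evalReal E.rho (tanhMoment (k + 1) y))) ∧
      E.checkPotential y = ∫ k : ℕ, ((E.dL : ℝ) / E.dR * (1 - evalReal E.R (tanhMoment (k + 1) y))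
        + E.dL * (1 - evalReal E.rho (tanhMoment (k + 1) y))
        - E.dL * (1 - tanhMoment (k + 1) y * evalReal E.rho (tanhMoment (k + 1) y))) ∂gammaMeas := by
    intro y hy
    have hr := chkPoly_mem E.rho_one hy
    have := hy.1
    have := hr.1
    have b0 := isBddMeas_tanhMoment hy
    have b1 := (IsBddMeas.const ((E.dL : ℝ) / E.dR)).mul
      ((IsBddMeas.const 1).sub (isBddMeas_evalReal E.R_one hy))
    have b2 := (IsBddMeas.const (E.dL : ℝ)).mul
      ((IsBddMeas.const 1).sub (isBddMeas_evalReal E.rho_one hy))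
    have b3 := (IsBddMeas.const (E.dL : ℝ)).mul
      ((IsBddMeas.const 1).sub (b0.mul (isBddMeas_evalReal E.rho_one hy)))
    refine ⟨(b1.add b2).sub b3, ?_⟩
    rw [integral_sub ((b1.add b2).integrable _) (b3.integrable _),
      integral_add (b1.integrable _) (b2.integrable _), integral_const_mul, integral_const_mul,
      integral_const_mul, checkPotential, entropy_eq_integral (chkPoly_mem E.R_one hy),
      entropy_eq_integral hr, entropy_eq_integral (chkOp_mem hy hr)]
    simp only [tanhMoment_chkPoly _ _ hy, tanhMoment_chkOp]
  obtain ⟨b, e⟩ := key hx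
  obtain ⟨b', e'⟩ := key hx'
  rw [e, e', ← integral_sub (b.integrable _) (b'.integrable _), ← integral_const_mul]
  refine integral_mono ((b.sub b').integrable _)
    (((IsBddMeas.const _).mul (((isBddMeas_evalReal E.rho_one hx').sub
      (isBddMeas_evalReal E.rho_one hx)).mul
        ((IsBddMeas.const 1).sub (isBddMeas_tanhMoment hx)))).integrable _) fun k => ?_
  have h := mul_le_mul_of_nonneg_left
    (evalReal_nodePersp_sub_le E.rho_one (tanhMoment_nonneg (k + 1) x) (hle (k + 1)))
    (show 0 ≤ (E.dL : ℝ) / E.dR by positivity)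
  rw [← mul_assoc, show ((nodePersp E.rho).derivative.eval 1 : ℝ≥0) = E.dR from rfl,
    div_mul_cancel₀ _ E.dR_ne_zero, show nodePersp E.rho = E.R from rfl] at h
  simp only
  linarith

end Ensemble

/-! ### Summation by parts along the chain -/

theorem sum_range_shift {f D : ℤ → ℝ} {n : ℕ} (hf : ∀ i ≤ 0, f i = 0)
    (hD : ∀ l : ℤ, (n : ℤ) < l → D l = 0) (j : ℕ) :
    ∑ i ∈ Finset.range n, f (i + 1) * D (i + 1 + j) =
      ∑ l ∈ Finset.range n, f (l + 1 - j) * D (l + 1) := by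
  have h1 : ∑ l ∈ Finset.range (n + j), f (l + 1 - j) * D (l + 1) =
      ∑ l ∈ Finset.range n, f (l + 1 - j) * D (l + 1) := by
    rw [Finset.sum_range_add, add_eq_left]
    refine Finset.sum_eq_zero fun l _ => ?_
    rw [hD _ (by push_cast; omega), mul_zero]
  have h2 : ∑ l ∈ Finset.range j, f (l + 1 - j) * D (l + 1) = 0 :=
    Finset.sum_eq_zero fun l hl => by
      rw [Finset.mem_range] at hl
      rw [hf _ (by omega), zero_mul]
  rw [← h1, add_comm n j, Finset.sum_range_add, h2, zero_add]
  refine Finset.sum_congr rfl fun l _ => ?_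
  congr 2 <;> push_cast <;> ring

/-- The forward window average is transposed into a backward one. No boundary terms arise: `f`
vanishes to the left, and the increments of `Y` vanish to the right. -/
theorem sum_by_parts_window {f Y : ℤ → ℝ} {n : ℕ} (w : ℕ) (hf : ∀ i ≤ 0, f i = 0)
    (hY : ∀ l : ℤ, (n : ℤ) ≤ l → Y l = Y n) :
    ∑ i ∈ Finset.range n, f (i + 1) * ((w : ℝ)⁻¹ * ∑ j ∈ Finset.range w, Y (i + j)
        - (w : ℝ)⁻¹ * ∑ j ∈ Finset.range w, Y (i + 1 + j)) =
      ∑ l ∈ Finset.range n, (Y l - Y (l + 1)) *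
        ((w : ℝ)⁻¹ * ∑ k ∈ Finset.range w, f (l + 1 - k)) := by
  have hshift := fun j : ℕ => sum_range_shift (f := f) (D := fun l => Y (l - 1) - Y l) hf
    (fun l hl => by rw [hY _ hl.le, hY _ (by omega), sub_self]) j
  calc _ = (w : ℝ)⁻¹ * ∑ j ∈ Finset.range w, ∑ i ∈ Finset.range n,
        f (i + 1) * (Y (i + 1 + j - 1) - Y (i + 1 + j)) := by
        rw [Finset.sum_comm, Finset.mul_sum]
        refine Finset.sum_congr rfl fun i _ => ?_
        rw [← mul_sub, ← Finset.sum_sub_distrib, ← Finset.mul_sum, mul_left_comm]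
        refine congrArg _ (congrArg _ (Finset.sum_congr rfl fun j _ => ?_))
        rw [show (i : ℤ) + 1 + j - 1 = i + j by ring]
    _ = (w : ℝ)⁻¹ * ∑ j ∈ Finset.range w, ∑ l ∈ Finset.range n,
        f (l + 1 - j) * (Y (l + 1 - 1) - Y (l + 1)) := by simp only [hshift]
    _ = _ := by
        rw [Finset.sum_comm, Finset.mul_sum]
        refine Finset.sum_congr rfl fun l _ => ?_
        rw [← Finset.sum_mul, add_sub_cancel_right]
        ring

/-! ### The one-sided chain -/

namespace Ensemble

variable (E : Ensemble)

/-- The average of the check-node outputs in the window starting at position `i`. -/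
def window (w : ℕ) (x : ℤ → Measure EReal) (i : ℤ) : Measure EReal :=
  average w fun j => chkPoly E.rho (x (i + j))

/-- The variable-node output at position `i` of the one-sided chain, whose channel is `c` at the
positions `i ≥ 1` and `Δ_∞` elsewhere. -/
def varOut (c : Measure EReal) (w : ℕ) (x : ℤ → Measure EReal) (i : ℤ) : Measure EReal :=
  varOp (if 1 ≤ i then c else deltaInf) (varPoly E.lam (E.window w x i))

/-- One iteration of the density evolution of the one-sided chain. -/
def chainStep (c : Measure EReal) (w : ℕ) (x : ℤ → Measure EReal) (i : ℤ) : Measure EReal :=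
  average w fun k => E.varOut c w x (i - k)

section chain

variable {E} {c : Measure EReal} {w : ℕ} {x : ℤ → Measure EReal}

theorem window_mem (hw : 0 < w) (hx : ∀ i, x i ∈ symProb) (i : ℤ) : E.window w x i ∈ symProb :=
  average_mem hw fun _ => chkPoly_mem E.rho_one (hx _)

theorem varOut_mem (hc : c ∈ symProb) (hw : 0 < w) (hx : ∀ i, x i ∈ symProb) (i : ℤ) :
    E.varOut c w x i ∈ symProb := by
  refine varOp_mem ?_ (varPoly_mem E.lam_one (window_mem hw hx i))
  split_ifs
  exacts [hc, deltaInf_mem]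

theorem chainStep_mem (hc : c ∈ symProb) (hw : 0 < w) (hx : ∀ i, x i ∈ symProb) (i : ℤ) :
    E.chainStep c w x i ∈ symProb :=
  average_mem hw fun _ => varOut_mem hc hw hx _

theorem varOut_of_pos {i : ℤ} (hi : 1 ≤ i) :
    E.varOut c w x i = varOp c (varPoly E.lam (E.window w x i)) := by
  rw [varOut, if_pos hi]

theorem varOut_of_nonpos (hw : 0 < w) (hx : ∀ i, x i ∈ symProb) {i : ℤ} (hi : i ≤ 0) :
    E.varOut c w x i = deltaInf := by
  rw [varOut, if_neg (by omega), deltaInf_varOp (varPoly_mem E.lam_one (window_mem hw hx i))]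

theorem chainStep_of_nonpos (hw : 0 < w) (hx : ∀ i, x i ∈ symProb) {i : ℤ} (hi : i ≤ 0) :
    E.chainStep c w x i = deltaInf := by
  have : ∀ k : ℕ, E.varOut c w x (i - k) = deltaInf := fun k =>
    varOut_of_nonpos hw hx (by omega)
  rw [chainStep]
  simp only [this]
  exact average_const hw _

theorem tanhMoment_window (hx : ∀ i, x i ∈ symProb) (k : ℕ) (i : ℤ) :
    tanhMoment k (E.window w x i) =
      (w : ℝ)⁻¹ * ∑ j ∈ Finset.range w, evalReal E.rho (tanhMoment k (x (i + j))) := by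
  rw [window, tanhMoment_average k w fun _ => chkPoly_mem E.rho_one (hx _)]
  simp only [tanhMoment_chkPoly _ _ (hx _)]

/-- Shifting the window replaces one entry out of `w`, so the sum telescopes to a single
check-output difference. This is the source of the factor 1/w. -/
theorem tanhMoment_varOp_window_sub_le (hw : 0 < w) (hx : ∀ i, x i ∈ symProb) {q : Measure EReal}
    (hq : q ∈ symProb) (k : ℕ) (i : ℤ) :
    tanhMoment k (varOp q (E.window w x i)) - tanhMoment k (varOp q (E.window w x (i + 1))) ≤
      (E.rho.derivative.eval 1 : ℝ≥0) / w := by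
  have hy : ∀ i, chkPoly E.rho (x i) ∈ symProb := fun i => chkPoly_mem E.rho_one (hx i)
  unfold tanhMoment
  rw [window, window, integral_varOp_average hw (fun _ => hy _) hq (isBddMeas_tau_pow _),
    integral_varOp_average hw (fun _ => hy _) hq (isBddMeas_tau_pow _), ← mul_sub,
    ← Finset.sum_sub_distrib]
  have h := Finset.sum_range_sub' (fun j : ℕ => tanhMoment k (varOp q (chkPoly E.rho (x (i + j))))) w
  unfold tanhMoment at h
  have e : ∀ j : ℕ, i + ((j + 1 : ℕ) : ℤ) = i + 1 + j := fun j => by push_cast; ring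
  simp only [e] at h
  rw [h, div_eq_inv_mul]
  refine mul_le_mul_of_nonneg_left ?_ (by positivity)
  exact E.tanhMoment_varOp_chkPoly_sub_le hq (hx _) (hx _) k

/-- The energy estimate: shifting the one-sided chain by one position costs at most the potential
at its saturated end. -/
theorem potential_le_of_chain (hc : c ∈ symProb) (hw : 0 < w) (hx : ∀ i, x i ∈ symProb)
    (h0 : x 0 = deltaInf) {n : ℕ} (hsat : ∀ i : ℤ, (n : ℤ) ≤ i → x i = x n)
    (hmono : ∀ i j, i ≤ j → ∀ k, tanhMoment k (x j) ≤ tanhMoment k (x i))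
    (hdec : ∀ i ≤ (n : ℤ), ∀ k, tanhMoment k (x i) ≤ tanhMoment k (E.chainStep c w x i)) :
    E.potential (x n) c ≤ E.dL * (E.lam.derivative.eval 1 : ℝ≥0) / 2 *
        ((E.rho.derivative.eval 1 : ℝ≥0) / w * (E.rho.derivative.eval 1 : ℝ≥0))
      + E.dL * ∑ l ∈ Finset.range n,
        (entropy (x (l + 1)) - entropy (E.chainStep c w x (l + 1))) := by
  have hz := fun i => window_mem (E := E) hw hx i
  have hu := fun i => varOut_mem (E := E) hc hw hx i
  have hxp := fun i => chainStep_mem (E := E) hc hw hx i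
  set z := fun i => E.window w x i with hzdef
  set u := fun i => E.varOut c w x i with hudef
  set xp := fun i => E.chainStep c w x i with hxpdef
  set Y : ℕ → ℤ → ℝ := fun k i => evalReal E.rho (tanhMoment k (x i)) with hYdef
  have hYmono : ∀ k i j, i ≤ j → Y k j ≤ Y k i := fun k i j hij =>
    evalReal_mono _ (tanhMoment_nonneg _ _) (hmono i j hij k)
  have hY01 : ∀ k i, 0 ≤ Y k i ∧ Y k i ≤ 1 := fun k i => by
    have := (hx i).1
    exact ⟨evalReal_nonneg _ (tanhMoment_nonneg _ _),
      evalReal_le_one E.rho_one (tanhMoment_nonneg _ _) (tanhMoment_le_one _ _)⟩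
  have hMz : ∀ k i, tanhMoment k (z i) = (w : ℝ)⁻¹ * ∑ j ∈ Finset.range w, Y k (i + j) :=
    fun k i => tanhMoment_window hx k i
  have hzn : z n = chkPoly E.rho (x n) := by
    have : ∀ j : ℕ, x (n + j) = x n := fun j => hsat _ (by omega)
    simp only [hzdef, window, this]
    exact average_const hw _
  set V : Measure EReal → ℝ := fun y => entropy (varOp c (varPoly E.L y)) with hV
  have hVtel : ∑ i ∈ Finset.range n, (V (z i) - V (z (i + 1))) = V (z 0) - V (z n) := by
    have := Finset.sum_range_sub' (fun i : ℕ => V (z i)) n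
    push_cast at this
    exact this
  have hHtel : ∑ i ∈ Finset.range n, (entropy (z (i + 1)) - entropy (z i))
      = entropy (z n) - entropy (z 0) := by
    have := Finset.sum_range_sub (fun i : ℕ => entropy (z i)) n
    push_cast at this
    exact this
  have hGtel : ∑ i ∈ Finset.range n, (E.checkPotential (x (i + 1)) - E.checkPotential (x i))
      = E.checkPotential (x n) := by
    have := Finset.sum_range_sub (fun i : ℕ => E.checkPotential (x i)) n
    push_cast at this
    rw [this, h0, checkPotential_deltaInf, sub_zero]
  have hV0 : 0 ≤ V (z 0) := entropy_nonneg (varOp_mem hc (varPoly_mem E.L_one (hz 0)))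
  -- The base point of the expansion is z(i + 1), so that the linear coefficient is the variable
  -- output u(i + 1).
  have hVstep : ∀ i : ℕ, V (z i) - V (z (i + 1)) ≤
      E.dL * (entropy (varOp (u (i + 1)) (z i)) - entropy (varOp (u (i + 1)) (z (i + 1))))
      + E.dL * (E.lam.derivative.eval 1 : ℝ≥0) / 2 *
        ((E.rho.derivative.eval 1 : ℝ≥0) / w * (entropy (z (i + 1)) - entropy (z i))) := fun i => by
    have hu1 : u (i + 1) = varOp c (varPoly E.lam (z (i + 1))) := varOut_of_pos (by omega)
    rw [hu1]
    refine E.entropy_var_taylor hc (hz _) (hz _) (fun k => ?_) fun q hq k =>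
      tanhMoment_varOp_window_sub_le hw hx hq k i
    rw [hMz, hMz]
    refine mul_le_mul_of_nonneg_left (Finset.sum_le_sum fun j _ => hYmono k _ _ (by omega))
      (by positivity)
  have bx := fun i => isBddMeas_tanhMoment (hx i)
  have bz := fun i => isBddMeas_tanhMoment (hz i)
  have bu := fun i => isBddMeas_tanhMoment (hu i)
  have bxp := fun i => isBddMeas_tanhMoment (hxp i)
  have bY : ∀ i, IsBddMeas fun k : ℕ => Y (k + 1) i := fun i => isBddMeas_evalReal E.rho_one (hx i)
  have b1 : ∀ l : ℕ, IsBddMeas fun k : ℕ =>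
      (Y (k + 1) l - Y (k + 1) (l + 1)) * (1 - tanhMoment (k + 1) (x (l + 1))) := fun l =>
    ((bY _).sub (bY _)).mul ((IsBddMeas.const 1).sub (bx _))
  have b2 : ∀ i : ℕ, IsBddMeas fun k : ℕ => (1 - tanhMoment (k + 1) (u (i + 1))) *
      (tanhMoment (k + 1) (z i) - tanhMoment (k + 1) (z (i + 1))) := fun i =>
    ((IsBddMeas.const 1).sub (bu _)).mul ((bz _).sub (bz _))
  have b3 : ∀ l : ℕ, IsBddMeas fun k : ℕ =>
      tanhMoment (k + 1) (xp (l + 1)) - tanhMoment (k + 1) (x (l + 1)) := fun l =>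
    (bxp _).sub (bx _)
  have hfirst : ∀ i : ℕ,
      entropy (varOp (u (i + 1)) (z i)) - entropy (varOp (u (i + 1)) (z (i + 1))) =
      -∫ k : ℕ, (1 - tanhMoment (k + 1) (u (i + 1))) *
        (tanhMoment (k + 1) (z i) - tanhMoment (k + 1) (z (i + 1))) ∂gammaMeas := fun i => by
    have c0 := (IsBddMeas.const 1).sub (bu (i + 1))
    rw [entropy_varOp (hu _) (hz _), entropy_varOp (hu _) (hz _),
      ← integral_sub ((c0.mul ((IsBddMeas.const 1).sub (bz _))).integrable _)
        ((c0.mul ((IsBddMeas.const 1).sub (bz _))).integrable _), ← integral_neg]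
    congr 1
    ext k
    ring
  have hent : ∀ l : ℕ, entropy (x (l + 1)) - entropy (xp (l + 1)) =
      ∫ k : ℕ, (tanhMoment (k + 1) (xp (l + 1)) - tanhMoment (k + 1) (x (l + 1))) ∂gammaMeas :=
    fun l => by
    rw [entropy_eq_integral (hx _), entropy_eq_integral (hxp _),
      ← integral_sub (((IsBddMeas.const 1).sub (bx _)).integrable _)
        (((IsBddMeas.const 1).sub (bxp _)).integrable _)]
    congr 1
    ext k
    ring
  have hG : ∀ l : ℕ, E.checkPotential (x (l + 1)) - E.checkPotential (x l) ≤ E.dL * ∫ k : ℕ,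
      (Y (k + 1) l - Y (k + 1) (l + 1)) * (1 - tanhMoment (k + 1) (x (l + 1))) ∂gammaMeas :=
    fun l => E.checkPotential_sub_le (hx _) (hx _) (hmono _ _ (by omega))
  -- The first-order terms of both parts: after summation by parts they differ only in having x(l +
  -- 1) or its image under one chain step.
  have hmain : ∑ l ∈ Finset.range n, ∫ k : ℕ,
        (Y (k + 1) l - Y (k + 1) (l + 1)) * (1 - tanhMoment (k + 1) (x (l + 1))) ∂gammaMeas
      - ∑ i ∈ Finset.range n, ∫ k : ℕ, (1 - tanhMoment (k + 1) (u (i + 1))) *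
        (tanhMoment (k + 1) (z i) - tanhMoment (k + 1) (z (i + 1))) ∂gammaMeas
      ≤ ∑ l ∈ Finset.range n, (entropy (x (l + 1)) - entropy (xp (l + 1))) := by
    simp only [hent]
    rw [← integral_finsetSum _ fun l _ => (b1 l).integrable _,
      ← integral_finsetSum _ fun l _ => (b2 l).integrable _,
      ← integral_finsetSum _ fun l _ => (b3 l).integrable _,
      ← integral_sub ((IsBddMeas.sum fun l _ => b1 l).integrable _)
        ((IsBddMeas.sum fun l _ => b2 l).integrable _)]
    refine integral_mono (((IsBddMeas.sum fun l _ => b1 l).sub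
      (IsBddMeas.sum fun l _ => b2 l)).integrable _)
      ((IsBddMeas.sum fun l _ => b3 l).integrable _) fun k => ?_
    simp only
    have hparts := sum_by_parts_window (f := fun i => 1 - tanhMoment (k + 1) (u i)) (Y := Y (k + 1))
      (n := n) w (fun i hi => by
        simp only [hudef]
        rw [varOut_of_nonpos hw hx hi, tanhMoment_deltaInf, sub_self])
      fun l hl => by simp only [hYdef]; rw [hsat l hl]
    simp only [hMz]
    rw [hparts, ← Finset.sum_sub_distrib]
    refine Finset.sum_le_sum fun l hl => ?_
    have hl' : (l : ℤ) + 1 ≤ n := by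
      have := Finset.mem_range.mp hl
      omega
    have hxp1 : (w : ℝ)⁻¹ * ∑ j ∈ Finset.range w, (1 - tanhMoment (k + 1) (u (l + 1 - j))) =
        1 - tanhMoment (k + 1) (xp (l + 1)) := by
      simp only [hxpdef]
      rw [chainStep, tanhMoment_average _ _ fun _ => hu _, Finset.sum_sub_distrib, mul_sub]
      simp only [Finset.sum_const, Finset.card_range, nsmul_eq_mul, mul_one]
      rw [inv_mul_cancel₀ (by exact_mod_cast hw.ne')]
    rw [hxp1, ← mul_sub, sub_sub_sub_cancel_left]
    -- The drop of Y is at most 1 and the moment gain is nonnegative, so the weight can be replaced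
    -- by 1.
    refine mul_le_of_le_one_left (sub_nonneg.mpr (hdec _ hl' _)) ?_
    linarith [(hY01 (k + 1) l).2, (hY01 (k + 1) (l + 1)).1]
  have hVsum := Finset.sum_le_sum fun i (_ : i ∈ Finset.range n) => hVstep i
  have hGsum := Finset.sum_le_sum fun i (_ : i ∈ Finset.range n) => hG i
  rw [hVtel, Finset.sum_add_distrib, ← Finset.mul_sum, ← Finset.mul_sum, ← Finset.mul_sum,
    hHtel] at hVsum
  simp only [hfirst, Finset.sum_neg_distrib, mul_neg] at hVsum
  rw [hGtel, ← Finset.mul_sum] at hGsum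
  have hz0 := entropy_nonneg (hz 0)
  have hHn : entropy (z n) ≤ (E.rho.derivative.eval 1 : ℝ≥0) :=
    hzn ▸ E.entropy_chkPoly_rho_le (hx n)
  have hquad : (E.dL : ℝ) * (E.lam.derivative.eval 1 : ℝ≥0) / 2 *
      ((E.rho.derivative.eval 1 : ℝ≥0) / w * (entropy (z n) - entropy (z 0))) ≤
      E.dL * (E.lam.derivative.eval 1 : ℝ≥0) / 2 *
        ((E.rho.derivative.eval 1 : ℝ≥0) / w * (E.rho.derivative.eval 1 : ℝ≥0)) := by
    gcongr
    linarith
  have hmain' := mul_le_mul_of_nonneg_left hmain (NNReal.coe_nonneg E.dL)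
  rw [mul_sub] at hmain'
  simp only [hxpdef] at hmain'
  have hpot : E.potential (x n) c = E.checkPotential (x n) - V (z n) := by
    rw [hzn]; rfl
  rw [hpot]
  linarith

end chain

end Ensemble

/-! ### Monotonicity of density evolution and of the energy gap -/

theorem entropy_deltaInf : entropy deltaInf = 0 := by
  rw [entropy_eq_integral deltaInf_mem]
  simp

theorem chkPoly_deltaInf {p : ℝ≥0[X]} (hp : p.eval 1 = 1) : chkPoly p deltaInf = deltaInf := by
  have h := chkPoly_mem hp deltaInf_mem
  refine eq_deltaInf_of_entropy_eq_zero h ?_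
  rw [entropy_eq_integral h]
  simp [tanhMoment_chkPoly _ _ deltaInf_mem, evalReal_one hp]

theorem varOp_deltaInf {x : Measure EReal} (hx : x ∈ symProb) : varOp x deltaInf = deltaInf := by
  rw [varOp_comm hx deltaInf_mem, deltaInf_varOp hx]

/-- Δ_∞ absorbs under ⊛, but a constant term would contribute Δ_0; this is where the absence of
degree-one variable nodes enters. -/
theorem varPoly_deltaInf {p : ℝ≥0[X]} (hp : p.eval 1 = 1) (h0 : p.eval 0 = 0) :
    varPoly p deltaInf = deltaInf := by
  have h := varPoly_mem hp deltaInf_mem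
  refine eq_deltaInf_of_entropy_eq_zero h ?_
  rw [entropy_eq_integral_entKernel h, integral_varPoly p deltaInf_mem isBddMeas_entKernel]
  refine Finset.sum_eq_zero fun n _ => ?_
  cases n with
  | zero =>
    rw [Polynomial.coeff_zero_eq_eval_zero, h0, NNReal.coe_zero, zero_mul]
  | succ n =>
    rw [← entropy_eq_integral_entKernel (varPow_mem deltaInf_mem _), opPow,
      varOp_deltaInf (varPow_mem deltaInf_mem n), entropy_deltaInf, mul_zero]

namespace Ensemble

variable (E : Ensemble)

theorem deStep_mem {c a : Measure EReal} (hc : c ∈ symProb) (ha : a ∈ symProb) :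
    E.deStep c a ∈ symProb :=
  varOp_mem hc (varPoly_mem E.lam_one (chkPoly_mem E.rho_one ha))

theorem deStep_iterate_mem {c a : Measure EReal} (hc : c ∈ symProb) (ha : a ∈ symProb) (l : ℕ) :
    (E.deStep c)^[l] a ∈ symProb := by
  induction l with
  | zero => exact ha
  | succ l ih =>
    rw [Function.iterate_succ_apply']
    exact E.deStep_mem hc ih

theorem deStep_degraded {c c' a a' : Measure EReal} (hc : c ∈ symProb) (hc' : c' ∈ symProb)
    (ha : a ∈ symProb) (ha' : a' ∈ symProb) (h : Degraded c c') (h' : Degraded a a') :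
    Degraded (E.deStep c a) (E.deStep c' a') := by
  have hr := chkPoly_mem E.rho_one ha
  have hr' := chkPoly_mem E.rho_one ha'
  exact h.varOp hc hc' (varPoly_mem E.lam_one hr) (varPoly_mem E.lam_one hr')
    ((h'.chkPoly ha ha' _).varPoly hr hr' _)

theorem mem_basin_iff {c a : Measure EReal} (hc : c ∈ symProb) : a ∈ E.basin c ↔
    a ∈ symProb ∧ Tendsto (fun l : ℕ => entropy ((E.deStep c)^[l] a)) atTop (𝓝 0) := by
  refine and_congr_right fun ha => ?_
  simp only [entropyDist_deltaInf (E.deStep_iterate_mem hc ha _)]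

theorem basin_subset {c c' : Measure EReal} (hc : c ∈ symProb) (hc' : c' ∈ symProb)
    (h : Degraded c c') : E.basin c ⊆ E.basin c' := by
  intro a ha
  rw [E.mem_basin_iff hc] at ha
  rw [E.mem_basin_iff hc']
  have hdeg : ∀ l, Degraded ((E.deStep c)^[l] a) ((E.deStep c')^[l] a) := fun l => by
    induction l with
    | zero => exact .refl _
    | succ l ih =>
      rw [Function.iterate_succ_apply', Function.iterate_succ_apply']
      exact E.deStep_degraded hc hc' (E.deStep_iterate_mem hc ha.1 l)
        (E.deStep_iterate_mem hc' ha.1 l) h ih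
  exact ⟨ha.1, squeeze_zero (fun l => entropy_nonneg (E.deStep_iterate_mem hc' ha.1 l))
    (fun l => (hdeg l).entropy_le (E.deStep_iterate_mem hc ha.1 l)
      (E.deStep_iterate_mem hc' ha.1 l)) ha.2⟩

/-- Two effects point the same way: a better channel enlarges the basin, shrinking the set of the
infimum, and it raises the potential, in which the channel occurs only through -H(c ⊛ ·). -/
theorem energyGap_mono {c c' : Measure EReal} (hc : c ∈ symProb) (hc' : c' ∈ symProb)
    (h : Degraded c c') : E.energyGap c ≤ E.energyGap c' := by
  refine le_iInf₂ fun x hx => (iInf₂_le x ⟨hx.1, fun hb => hx.2 (E.basin_subset hc hc' h hb)⟩).trans ?_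
  have hL := varPoly_mem E.L_one (chkPoly_mem E.rho_one hx.1)
  rw [EReal.coe_le_coe_iff]
  exact sub_le_sub_left ((h.varOp hc hc' hL hL (.refl _)).entropy_le (varOp_mem hc hL)
    (varOp_mem hc' hL)) _

/-- The energy gap is positive below the potential threshold. -/
theorem energyGap_pos {c : ℝ → Measure EReal} (hc : IsBMSFamily c) {h : ℝ}
    (h_mem : h ∈ Set.Icc (0 : ℝ) 1) (h_lt : h < E.potentialThreshold c) :
    0 < E.energyGap (c h) := by
  have hne : {h | h ∈ Set.Icc (0 : ℝ) 1 ∧ 0 < E.energyGap (c h)}.Nonempty := by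
    by_contra hne
    -- The real supremum of the empty set is 0, which no h ≥ 0 lies below.
    rw [potentialThreshold, Set.not_nonempty_iff_eq_empty.mp hne, Real.sSup_empty] at h_lt
    exact absurd h_mem.1 (not_le.mpr h_lt)
  obtain ⟨h', hh', hlt⟩ := exists_lt_of_lt_csSup hne h_lt
  exact hh'.2.trans_le (E.energyGap_mono (hc.mem h' hh'.1) (hc.mem h h_mem)
    (hc.degraded h' hh'.1 h h_mem hlt.le))

/-! ### Monotonicity of the one-sided chain and its iterates -/

section chain

variable {E} {c : Measure EReal} {w : ℕ}

theorem window_degraded {x x' : ℤ → Measure EReal} (hx : ∀ i, x i ∈ symProb)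
    (hx' : ∀ i, x' i ∈ symProb) {i j : ℤ} (h : ∀ k : ℕ, Degraded (x (j + k)) (x' (i + k))) :
    Degraded (E.window w x j) (E.window w x' i) :=
  degraded_average w (fun _ => chkPoly_mem E.rho_one (hx _))
    (fun _ => chkPoly_mem E.rho_one (hx' _)) fun k => (h k).chkPoly (hx _) (hx' _) _

/-- Comparing x at `j` with x' at any `i ≤ j` treats monotonicity in space and in time together; the
channel also gets worse from left to right. -/
theorem chainStep_degraded (hc : c ∈ symProb) (hw : 0 < w) {x x' : ℤ → Measure EReal}
    (hx : ∀ i, x i ∈ symProb) (hx' : ∀ i, x' i ∈ symProb)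
    (h : ∀ i j, i ≤ j → Degraded (x j) (x' i)) {i j : ℤ} (hij : i ≤ j) :
    Degraded (E.chainStep c w x j) (E.chainStep c w x' i) := by
  refine degraded_average w (fun _ => varOut_mem hc hw hx _) (fun _ => varOut_mem hc hw hx' _)
    fun k => ?_
  refine Degraded.varOp (by split_ifs; exacts [hc, deltaInf_mem])
    (by split_ifs; exacts [hc, deltaInf_mem]) (varPoly_mem E.lam_one (window_mem hw hx _))
    (varPoly_mem E.lam_one (window_mem hw hx' _)) ?_
    ((window_degraded hx hx' fun m => h _ _ (by omega)).varPoly (window_mem hw hx _)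
      (window_mem hw hx' _) _)
  split_ifs with h1 h2 h2
  · exact .refl _
  · exact degraded_deltaInf hc
  · omega
  · exact .refl _

variable (E c w) in
/-- The iterates of density evolution on the one-sided chain saturated at position `n`, started
from the useless channel `Δ_0`. -/
def chainIter (n : ℕ) : ℕ → ℤ → Measure EReal
  | 0 => fun i => if 1 ≤ i then deltaZero else deltaInf
  | l + 1 => fun i => E.chainStep c w (chainIter n l) (min i n)

variable {n : ℕ}

theorem chainIter_mem (hc : c ∈ symProb) (hw : 0 < w) (l : ℕ) (i : ℤ) :
    E.chainIter c w n l i ∈ symProb := by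
  induction l generalizing i with
  | zero =>
    simp only [chainIter]
    split_ifs
    exacts [deltaZero_mem, deltaInf_mem]
  | succ l ih => exact chainStep_mem hc hw ih _

theorem chainIter_of_nonpos (hc : c ∈ symProb) (hw : 0 < w) (l : ℕ) {i : ℤ} (hi : i ≤ 0) :
    E.chainIter c w n l i = deltaInf := by
  cases l with
  | zero => exact if_neg (by omega)
  | succ l => exact chainStep_of_nonpos hw (chainIter_mem hc hw l) (by omega)

theorem chainIter_of_le (hn : 0 < n) (l : ℕ) {i : ℤ} (hi : (n : ℤ) ≤ i) :
    E.chainIter c w n l i = E.chainIter c w n l n := by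
  cases l with
  | zero => exact (if_pos (by omega)).trans (if_pos (by omega)).symm
  | succ l => simp only [chainIter, min_eq_right hi, min_self]

theorem chainIter_degraded_of_le (hc : c ∈ symProb) (hw : 0 < w) (l : ℕ) {i j : ℤ} (hij : i ≤ j) :
    Degraded (E.chainIter c w n l j) (E.chainIter c w n l i) := by
  induction l generalizing i j with
  | zero =>
    simp only [chainIter]
    split_ifs
    · exact .refl _
    · exact degraded_deltaInf deltaZero_mem
    · omega
    · exact .refl _
  | succ l ih =>
    exact chainStep_degraded hc hw (chainIter_mem hc hw l) (chainIter_mem hc hw l)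
      (fun _ _ h => ih h) (min_le_min_right _ hij)

theorem chainIter_degraded_last (hc : c ∈ symProb) (hw : 0 < w) (hn : 0 < n) (l : ℕ) (i : ℤ) :
    Degraded (E.chainIter c w n l n) (E.chainIter c w n l i) := by
  rcases le_total i n with h | h
  · exact chainIter_degraded_of_le hc hw l h
  · rw [chainIter_of_le hn l h]
    exact .refl _

theorem chainIter_degraded_succ (hc : c ∈ symProb) (hw : 0 < w) (l : ℕ) (i : ℤ) :
    Degraded (E.chainIter c w n l i) (E.chainIter c w n (l + 1) i) := by
  induction l generalizing i with
  | zero =>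
    by_cases hi : 1 ≤ i
    · rw [show E.chainIter c w n 0 i = deltaZero from if_pos hi]
      exact degraded_deltaZero (chainIter_mem hc hw _ _)
    · rw [chainIter_of_nonpos hc hw 0 (by omega), chainIter_of_nonpos hc hw (0 + 1) (by omega)]
      exact .refl _
  | succ l ih =>
    exact chainStep_degraded hc hw (chainIter_mem hc hw l) (chainIter_mem hc hw (l + 1))
      (fun i j h => (chainIter_degraded_of_le hc hw l h).trans (ih i)) le_rfl

/-- The uncoupled recursion sees the channel `c` and the worst law X_l(n) at every place of the
windows, hence stays behind the chain. -/
theorem deStep_iterate_degraded_chainIter (hc : c ∈ symProb) (hw : 0 < w) (hn : 0 < n) (l m : ℕ) :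
    Degraded ((E.deStep c)^[m] (E.chainIter c w n l n)) (E.chainIter c w n (l + m) n) := by
  have hX := fun l => chainIter_mem (E := E) (n := n) hc hw l
  have step : ∀ l, Degraded (E.deStep c (E.chainIter c w n l n))
      (E.chainIter c w n (l + 1) n) := fun l => by
    have hr := chkPoly_mem E.rho_one (hX l n)
    -- The uncoupled step is written as an average of `w` equal copies and compared term by term.
    have h := degraded_average w (f := fun _ => E.deStep c (E.chainIter c w n l n))
      (g := fun k => E.varOut c w (E.chainIter c w n l) (n - k)) (fun _ => E.deStep_mem hc (hX l n))
      (fun _ => varOut_mem hc hw (hX l) _) fun k => by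
      have hw' := window_mem (E := E) hw (hX l) (n - k)
      refine Degraded.varOp hc (by split_ifs; exacts [hc, deltaInf_mem])
        (varPoly_mem E.lam_one hr) (varPoly_mem E.lam_one hw') ?_ (.varPoly hr hw' ?_ _)
      · split_ifs
        exacts [.refl _, degraded_deltaInf hc]
      · have := window_degraded (E := E) (w := w) (x := fun _ => E.chainIter c w n l n) (j := 0)
          (fun _ => hX l n) (hX l) (i := n - k) fun m => chainIter_degraded_last hc hw hn l _
        rwa [window, average_const hw] at this
    rw [average_const hw] at h
    simp only [chainIter, min_self]
    exact h
  induction m with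
  | zero => exact .refl _
  | succ m ih =>
    rw [Function.iterate_succ_apply']
    exact (E.deStep_degraded hc hc (E.deStep_iterate_mem hc (hX l n) m) (hX _ _) (.refl _) ih).trans
      (step _)

end chain

end Ensemble

/-! ### The coupled chain is dominated by the one-sided chain -/

theorem extend_mem {N w : ℕ} {x : CheckPos N w → Measure EReal} (hx : ∀ i, x i ∈ symProb) (i : ℤ) :
    extend x i ∈ symProb := by
  unfold extend
  split_ifs
  exacts [hx _, deltaInf_mem]

theorem channelAt_mem {N : ℕ} {c : Measure EReal} (hc : c ∈ symProb) (i : ℤ) :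
    channelAt N c i ∈ symProb := by
  unfold channelAt
  split_ifs
  exacts [hc, deltaInf_mem]

/-- Starting from Δ_0 and giving up the perfect right boundary can only degrade, and by monotonicity
every iterate remains worse than the fixed point. -/
theorem chainIter_degraded_extend {E : Ensemble} {c : Measure EReal} (hc : c ∈ symProb) {N w : ℕ}
    (hw : 0 < w) {x : CheckPos N w → Measure EReal} (hx : x ∈ E.coupledFixedPoints N w c) (l : ℕ)
    (i : ℤ) : Degraded (E.chainIter c w (2 * N + w - 1) l i) (extend x i) := by
  have hX := fun l => Ensemble.chainIter_mem (E := E) (n := 2 * N + w - 1) hc hw l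
  have hext := extend_mem hx.1
  induction l generalizing i with
  | zero =>
    by_cases hi : 1 ≤ i
    · rw [show E.chainIter c w _ 0 i = deltaZero from if_pos hi]
      exact degraded_deltaZero (hext i)
    · rw [show extend x i = deltaInf from dif_neg fun h => hi h.1]
      exact degraded_deltaInf (hX _ _)
  | succ l ih =>
    by_cases hi : i ∈ Set.Icc (1 : ℤ) (2 * (N : ℤ) + (w : ℤ) - 1)
    · have hfix : extend x i = E.coupledStep c x ⟨i, hi⟩ := by
        rw [hx.2]
        exact dif_pos hi
      have hmin : min i ((2 * N + w - 1 : ℕ) : ℤ) = i := min_eq_left (by have := hi.2; omega)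
      rw [hfix]
      simp only [Ensemble.chainIter, hmin]
      have hy : ∀ i, chkPoly E.rho (extend x i) ∈ symProb := fun i =>
        chkPoly_mem E.rho_one (hext i)
      refine degraded_average w (fun _ => Ensemble.varOut_mem hc hw (hX l) _)
        (fun k => varOp_mem (channelAt_mem hc _)
          (varPoly_mem E.lam_one (average_mem hw fun _ => hy _))) fun k => ?_
      refine Degraded.varOp (by split_ifs; exacts [hc, deltaInf_mem]) (channelAt_mem hc _)
        (varPoly_mem E.lam_one (Ensemble.window_mem hw (hX l) _))
        (varPoly_mem E.lam_one (average_mem hw fun _ => hy _)) ?_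
        (.varPoly (Ensemble.window_mem hw (hX l) _) (average_mem hw fun _ => hy _)
          (Ensemble.window_degraded (hX l) hext fun _ => ih _) _)
      unfold channelAt
      split_ifs with h1 h2 h2
      · exact .refl _
      · exact degraded_deltaInf hc
      · exact absurd h2.1 h1
      · exact .refl _
    · rw [show extend x i = deltaInf from dif_neg hi]
      exact degraded_deltaInf (hX _ _)

theorem deltaInf_mem_coupledFixedPoints (E : Ensemble) {c : Measure EReal} (hc : c ∈ symProb)
    {N w : ℕ} (hw : 0 < w) : (fun _ => deltaInf) ∈ E.coupledFixedPoints N w c := by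
  refine ⟨fun _ => deltaInf_mem, ?_⟩
  have hext : ∀ i, extend (fun _ : CheckPos N w => deltaInf) i = deltaInf := fun i => by
    unfold extend
    split_ifs <;> rfl
  ext1 i
  simp only [Ensemble.coupledStep, hext, chkPoly_deltaInf E.rho_one, average_const hw,
    varPoly_deltaInf E.lam_one E.lam_zero, varOp_deltaInf (channelAt_mem hc _)]

/-- If the coupled chain has a nontrivial fixed point, then the energy gap is at most
`L'(1) λ'(1) ρ'(1)² / (2 w)`. -/
theorem energyGap_le_of_fixedPoint {E : Ensemble} {c : Measure EReal} (hc : c ∈ symProb) {N w : ℕ}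
    (hw : 0 < w) {x : CheckPos N w → Measure EReal} (hx : x ∈ E.coupledFixedPoints N w c)
    (hne : x ≠ fun _ => deltaInf) : E.energyGap c ≤
      (((E.dL : ℝ) * (E.lam.derivative.eval 1 : ℝ≥0) / 2 *
        ((E.rho.derivative.eval 1 : ℝ≥0) / w * (E.rho.derivative.eval 1 : ℝ≥0)) : ℝ) : EReal) := by
  obtain ⟨i, hi⟩ := Function.ne_iff.mp hne
  set n := 2 * N + w - 1 with hn
  have hn0 : 0 < n := by
    have h1 := i.2.1
    have h2 := i.2.2
    omega
  set X := E.chainIter c w n with hXdef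
  have hX : ∀ l i, X l i ∈ symProb := Ensemble.chainIter_mem hc hw
  have hpos : 0 < entropy (x i) := lt_of_le_of_ne (entropy_nonneg (hx.1 i)) fun h =>
    hi (eq_deltaInf_of_entropy_eq_zero (hx.1 i) h.symm)
  -- Every uncoupled iterate from X_l(n) is degraded with respect to the nontrivial component x(i),
  -- so its entropy stays above H(x(i)) > 0.
  have hbasin : ∀ l, X l n ∈ symProb \ E.basin c := fun l => by
    refine ⟨hX l n, fun hb => ?_⟩
    have hlim := ((E.mem_basin_iff hc).mp hb).2
    refine not_le.mpr hpos (ge_of_tendsto' hlim fun m => ?_)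
    have hxi : extend x i = x i := dif_pos i.2
    have hdeg := (Ensemble.deStep_iterate_degraded_chainIter (E := E) hc hw hn0 l m).trans
      ((Ensemble.chainIter_degraded_last hc hw hn0 (l + m) i).trans
        (chainIter_degraded_extend hc hw hx (l + m) i))
    rw [hxi] at hdeg
    exact hdeg.entropy_le (E.deStep_iterate_mem hc (hX l n) m) (hx.1 i)
  have hstep : ∀ l (i : ℤ), i ≤ n → E.chainStep c w (X l) i = X (l + 1) i := fun l i hi => by
    simp only [hXdef, Ensemble.chainIter, min_eq_left hi]
  have hbound : ∀ l, E.potential (X l n) c ≤ (E.dL : ℝ) * (E.lam.derivative.eval 1 : ℝ≥0) / 2 *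
        ((E.rho.derivative.eval 1 : ℝ≥0) / w * (E.rho.derivative.eval 1 : ℝ≥0)) + E.dL *
        ∑ j ∈ Finset.range n, (entropy (X l (j + 1)) - entropy (X (l + 1) (j + 1))) := fun l => by
    refine (Ensemble.potential_le_of_chain (E := E) hc hw (hX l)
      (Ensemble.chainIter_of_nonpos hc hw l le_rfl)
      (fun i hi => Ensemble.chainIter_of_le hn0 l hi)
      (fun i j hij => (Ensemble.chainIter_degraded_of_le hc hw l hij).tanhMoment_le)
      fun i hi k => ?_).trans_eq ?_
    · rw [hstep l i hi]
      exact (Ensemble.chainIter_degraded_succ hc hw l i).tanhMoment_le k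
    · congr 2
      refine Finset.sum_congr rfl fun j hj => ?_
      rw [hstep l _ (by have := Finset.mem_range.mp hj; omega)]
  -- At each position the entropies decrease and are nonnegative, so they converge and consecutive
  -- differences vanish.
  have hlim : ∀ i, Tendsto (fun l => entropy (X l i) - entropy (X (l + 1) i)) atTop (𝓝 0) :=
    fun i => by
    have hanti : Antitone fun l => entropy (X l i) := antitone_nat_of_succ_le fun l =>
      (Ensemble.chainIter_degraded_succ hc hw l i).entropy_le (hX _ _) (hX _ _)
    have hconv := tendsto_atTop_ciInf hanti ⟨0, by
      rintro _ ⟨l, rfl⟩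
      exact entropy_nonneg (hX _ _)⟩
    simpa using hconv.sub (hconv.comp (tendsto_add_atTop_nat 1))
  have hsum := (tendsto_finsetSum (Finset.range n) fun j _ => hlim ((j : ℤ) + 1)).const_mul
    (E.dL : ℝ)
  have htot := hsum.const_add ((E.dL : ℝ) * (E.lam.derivative.eval 1 : ℝ≥0) / 2 *
        ((E.rho.derivative.eval 1 : ℝ≥0) / w * (E.rho.derivative.eval 1 : ℝ≥0)))
  rw [Finset.sum_const_zero, mul_zero, add_zero] at htot
  refine ge_of_tendsto' ((continuous_coe_real_ereal.tendsto _).comp htot) fun l => ?_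
  exact (iInf₂_le (X l n) (hbasin l)).trans (EReal.coe_le_coe_iff.mpr (hbound l))

/-- Only the last summand of K is needed; the terms with ρ''(1) and ρ'(1) are dropped as
nonnegative. -/
theorem Ensemble.two_mul_le_K (E : Ensemble) : 2 * ((E.dL : ℝ) * (E.lam.derivative.eval 1 : ℝ≥0) *
    ((E.rho.derivative.eval 1 : ℝ≥0) * (E.rho.derivative.eval 1 : ℝ≥0))) ≤ E.K := by
  rw [Ensemble.K]
  push_cast
  have h1 : 0 ≤ (E.dL : ℝ) * (2 * (E.rho.derivative.derivative.eval 1 : ℝ≥0)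
      + (E.rho.derivative.eval 1 : ℝ≥0)) := by positivity
  linarith

end

end SCLDPC

/-- Threshold saturation (achievability): below the potential threshold, the only fixed point of
the density evolution of the spatially-coupled ensemble is the all-`Δ_∞` vector, for every chain
length and every coupling width `w > K_{λ,ρ} / (2 ΔE(c(h)))`. -/
theorem mainTheorem1 (E : SCLDPC.Ensemble) (c : ℝ → MeasureTheory.Measure EReal)
    (hc : SCLDPC.IsBMSFamily c) (h : ℝ) (h_mem : h ∈ Set.Icc (0 : ℝ) 1)
    (h_lt : h < E.potentialThreshold c) (N w : ℕ)
    (hw : (((E.K : ℝ) : EReal) / (2 * E.energyGap (c h))) < (w : EReal)) :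
    E.coupledFixedPoints N w (c h) = {fun _ => SCLDPC.deltaInf} := by
  have hch := hc.mem h h_mem
  have hgap := E.energyGap_pos hc h_mem h_lt
  have hw0 : 0 < w := by
    have h0 : (0 : EReal) ≤ ((E.K : ℝ) : EReal) / (2 * E.energyGap (c h)) :=
      EReal.div_nonneg (by exact_mod_cast E.K.2) (mul_nonneg zero_le_two hgap.le)
    exact_mod_cast h0.trans_lt hw
  refine Set.Subset.antisymm (fun x hx => ?_) ?_
  · by_contra hne
    have hle := SCLDPC.energyGap_le_of_fixedPoint hch hw0 hx hne
    -- The bound from the fixed point is finite, which disposes of an infinite gap.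
    have htop : E.energyGap (c h) ≠ ⊤ := fun ht => by
      rw [ht, top_le_iff] at hle
      exact EReal.coe_ne_top _ hle
    lift E.energyGap (c h) to ℝ using ⟨htop, (EReal.bot_lt_zero.trans hgap).ne'⟩ with d
    have hd : 0 < d := by exact_mod_cast hgap
    have hle' := EReal.coe_le_coe_iff.mp hle
    have hw' : (E.K : ℝ) / (2 * d) < w := by
      have h2 : (2 : EReal) * (d : EReal) = ((2 * d : ℝ) : EReal) := rfl
      rw [h2, ← EReal.coe_div] at hw
      exact_mod_cast hw
    have hwpos : (0 : ℝ) < w := by exact_mod_cast hw0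
    have hK := E.two_mul_le_K
    rw [div_lt_iff₀ (by positivity)] at hw'
    have hmul := mul_le_mul_of_nonneg_right hle' hwpos.le
    field_simp at hmul
    -- With A = L'(1) λ'(1) ρ'(1)²: 4dw ≤ 2A ≤ K < 2dw, impossible for dw > 0.
    nlinarith [mul_pos hd hwpos]
  · rw [Set.singleton_subset_iff]
    exact SCLDPC.deltaInf_mem_coupledFixedPoints E hch hw0
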